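/- All categories, functors and adjunctions are enriched over the category $\mathbf{Pos}$ of posets and monotone maps: hom-sets are posets, composition is monotone, functors are monotone on hom-sets, and an enriched right adjoint is a functor having an (enriched) left adjoint. A concrete category over $\mathbf{Pos}$ is a category $\mathcal K$ with a faithful functor $U\colon\mathcal K\to\mathbf{Pos}$. For a finitary signature $\Sigma$, an ordered $\Sigma$-algebra is a poset with monotone operations interpreting the symbols of $\Sigma$; morphisms are the monotone homomorphisms, ordered pointwise. A variety is the full subcategory of all ordered $\Sigma$-algebras satisfying a given set of inequations $s\le t$ between $\Sigma$-terms, and $U_{\mathcal V}\colon\mathcal V\to\mathbf{Pos}$ is its forgetful functor. $(\mathcal K,U)$ is equivalent to a variety if there are a variety $\mathcal V$ and an (enriched) equivalence $E\colon\mathcal K\to\mathcal V$ with $U=U_{\mathcal V}E$. A coinserter of $u_0,u_1\colon V\to X$ is a morphism $f\colon X\to Y$ with $fu_0\le fu_1$ such that every $f'\colon X\to Y'$ with $f'u_0\le f'u_1$ has the form $f'=gf$, and $gf\le \bar gf$ implies $g\le\bar g$ for all $g,\bar g\colon Y\to Y'$. It is reflexive if $u_0d=u_1d=\mathrm{id}_X$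 for some $d\colon X\to V$. A subregular epimorphism is a coinserter of some parallel pair. A subkernel pair of $f\colon X\to Y$ is a pair $u_0,u_1\colon V\to X$ with $fu_0\le fu_1$ such that every pair $v_0,v_1\colon W\to X$ with $fv_0\le fv_1$ factorizes as $v_i=u_ik$ ($i=0,1$), and $u_ik\le u_i\bar k$ ($i=0,1$) implies $k\le\bar k$ for all $k,\bar k\colon W\to V$. A functor is finitary if it preserves (enriched, i.e. conical) colimits of diagrams indexed by small filtered categories. **Corollary 6.2.** A concrete category $(\mathcal K,U)$ over $\mathbf{Pos}$ is equivalent to a variety of ordered algebras if and only if 1. $\mathcal K$ has subkernel pairs (of all morphisms) and reflexive coinserters (of all reflexive pairs), and 2. $U$ is a finitary right adjoint which reflects subregular epimorphisms (if $Uf$ is a subregular epimorphism in $\mathbf{Pos}$, then $f$ is one in $\mathcal K$) and preserves reflexive coinserters. -/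

import Mathlib

open CategoryTheory CategoryTheory.Limits

universe u v w v' w'

namespace OrderedVarieties

/-! ### Categories and functors enriched over posets -/

/-- Enrichment of a category over the category of posets: every hom-set carries a partial order
and composition is monotone. -/
class PosEnriched (K : Type w) [Category.{v} K] where
  homOrder : ∀ X Y : K, PartialOrder (X ⟶ Y)
  comp_le_comp : ∀ {X Y Z : K} {f f' : X ⟶ Y} {g g' : Y ⟶ Z},
    f ≤ f' → g ≤ g' → f ≫ g ≤ f' ≫ g'

attribute [reducible, instance] PosEnriched.homOrder

/-- The category of posets, with monotone maps ordered pointwise. -/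
instance : PosEnriched PartOrd.{u} where
  homOrder X Y := PartialOrder.lift (fun f : X ⟶ Y => f.hom) (fun _ _ h => PartOrd.hom_ext h)
  comp_le_comp {_ _ _} {f _} {_ g'} hf hg := fun x => (hg (f.hom x)).trans (g'.hom.monotone (hf x))

/-- A functor is enriched over posets if it is monotone on hom-sets. -/
def IsPosFunctor {K : Type w} [Category.{v} K] [PosEnriched K]
    {L : Type w'} [Category.{v'} L] [PosEnriched L] (F : K ⥤ L) : Prop :=
  ∀ ⦃X Y : K⦄ ⦃f g : X ⟶ Y⦄, f ≤ g → F.map f ≤ F.map g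

/-- An enriched equivalence: an equivalence of the underlying categories whose action on each
hom-poset is an isomorphism of posets. -/
def IsPosEquivalence {K : Type w} [Category.{v} K] [PosEnriched K]
    {L : Type w'} [Category.{v'} L] [PosEnriched L] (E : K ⥤ L) : Prop :=
  E.IsEquivalence ∧ ∀ ⦃X Y : K⦄ (f g : X ⟶ Y), E.map f ≤ E.map g ↔ f ≤ g

/-- `U` is an enriched right adjoint: it has a left adjoint which is an enriched functor.
For enriched `U` the natural bijections between hom-sets are then isomorphisms of posets. -/
def IsPosRightAdjoint {K : Type w} [Category.{v} K] [PosEnriched K]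
    {L : Type w'} [Category.{v'} L] [PosEnriched L] (U : K ⥤ L) : Prop :=
  ∃ F : L ⥤ K, IsPosFunctor F ∧ Nonempty (F ⊣ U)

/-! ### Coinserters, subregular epimorphisms, subkernel pairs -/

section

variable {K : Type w} [Category.{v} K] [PosEnriched K]

/-- `f` is a coinserter of the ordered parallel pair `u₀, u₁`: it is universal with respect to
`u₀ ≫ f ≤ u₁ ≫ f`, in the enriched sense. -/
structure IsCoinserter {V X Y : K} (u₀ u₁ : V ⟶ X) (f : X ⟶ Y) : Prop where
  condition : u₀ ≫ f ≤ u₁ ≫ f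
  exists_desc : ∀ {Y' : K} (f' : X ⟶ Y'), u₀ ≫ f' ≤ u₁ ≫ f' → ∃ g : Y ⟶ Y', f ≫ g = f'
  le_of_comp_le : ∀ {Y' : K} (g g' : Y ⟶ Y'), f ≫ g ≤ f ≫ g' → g ≤ g'

/-- A subregular epimorphism is a coinserter of some parallel pair. -/
def IsSubregularEpi {X Y : K} (f : X ⟶ Y) : Prop :=
  ∃ (V : K) (u₀ u₁ : V ⟶ X), IsCoinserter u₀ u₁ f

/-- A reflexive pair: a pair of split epimorphisms with a joint splitting. -/
def IsReflexivePos {V X : K} (u₀ u₁ : V ⟶ X) : Prop :=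
  ∃ d : X ⟶ V, d ≫ u₀ = 𝟙 X ∧ d ≫ u₁ = 𝟙 X

/-- `u₀, u₁` is a subkernel pair (also called prekernel pair) of `f`: it is universal with respect
to `u₀ ≫ f ≤ u₁ ≫ f`, in the enriched sense. -/
structure IsSubkernelPair {V X Y : K} (f : X ⟶ Y) (u₀ u₁ : V ⟶ X) : Prop where
  condition : u₀ ≫ f ≤ u₁ ≫ f
  exists_lift : ∀ {W : K} (v₀ v₁ : W ⟶ X), v₀ ≫ f ≤ v₁ ≫ f →
    ∃ k : W ⟶ V, k ≫ u₀ = v₀ ∧ k ≫ u₁ = v₁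
  le_of_comp_le : ∀ {W : K} (k k' : W ⟶ V), k ≫ u₀ ≤ k' ≫ u₀ → k ≫ u₁ ≤ k' ≫ u₁ → k ≤ k'

variable (K) in
/-- Every morphism has a subkernel pair. -/
def HasSubkernelPairs : Prop :=
  ∀ ⦃X Y : K⦄ (f : X ⟶ Y), ∃ (V : K) (u₀ u₁ : V ⟶ X), IsSubkernelPair f u₀ u₁

variable (K) in
/-- Every reflexive pair has a coinserter. -/
def HasReflexiveCoinserters : Prop :=
  ∀ ⦃V X : K⦄ (u₀ u₁ : V ⟶ X), IsReflexivePos u₀ u₁ →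
    ∃ (Y : K) (f : X ⟶ Y), IsCoinserter u₀ u₁ f

/-- A cocone is a conical (that is, enriched) colimit cocone: it is a colimit cocone, and the
resulting bijection between morphisms out of the colimit and cocones is an isomorphism of posets,
cocones being ordered componentwise. -/
def IsConicalColimit {J : Type w'} [Category.{v'} J] {D : J ⥤ K} (c : Cocone D) : Prop :=
  Nonempty (IsColimit c) ∧
    ∀ {X : K} (f g : c.pt ⟶ X), (∀ j, c.ι.app j ≫ f ≤ c.ι.app j ≫ g) → f ≤ g

end

section

variable {K : Type w} [Category.{v} K] [PosEnriched K] (U : K ⥤ PartOrd.{u})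

/-- `U` is finitary: it preserves (enriched) filtered colimits. -/
def IsFinitary : Prop :=
  ∀ (J : Type u) [Category.{u} J] [IsFiltered J] (D : J ⥤ K) (c : Cocone D),
    IsConicalColimit c → IsConicalColimit (U.mapCocone c)

/-- `U` preserves coinserters of reflexive pairs. -/
def PreservesReflexiveCoinserters : Prop :=
  ∀ ⦃V X Y : K⦄ (u₀ u₁ : V ⟶ X) (f : X ⟶ Y), IsReflexivePos u₀ u₁ →
    IsCoinserter u₀ u₁ f → IsCoinserter (U.map u₀) (U.map u₁) (U.map f)

/-- `U` reflects subregular epimorphisms. -/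
def ReflectsSubregularEpis : Prop :=
  ∀ ⦃X Y : K⦄ (f : X ⟶ Y), IsSubregularEpi (U.map f) → IsSubregularEpi f

end

/-! ### Varieties of ordered algebras -/

/-- An ordered algebra for a finitary signature, where `S n` is the set of `n`-ary operation
symbols: a poset with a monotone `n`-ary operation for each `n`-ary symbol. -/
structure OrdAlg (S : ℕ → Type u) where
  carrier : Type u
  [order : PartialOrder carrier]
  op : ∀ {n : ℕ}, S n → (Fin n → carrier) → carrier
  op_mono : ∀ {n : ℕ} (s : S n), Monotone (op s)

attribute [instance] OrdAlg.order

namespace OrdAlg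

variable {S : ℕ → Type u}

/-- Morphisms of ordered algebras: monotone homomorphisms. -/
@[ext]
structure Hom (A B : OrdAlg S) where
  toOrderHom : A.carrier →o B.carrier
  map_op : ∀ {n : ℕ} (s : S n) (x : Fin n → A.carrier),
    toOrderHom (A.op s x) = B.op s (fun i => toOrderHom (x i))

instance : Category.{u} (OrdAlg S) where
  Hom A B := Hom A B
  id A := ⟨OrderHom.id, fun _ _ => rfl⟩
  comp f g := ⟨g.toOrderHom.comp f.toOrderHom, fun s x => by
    simp only [OrderHom.comp_coe, Function.comp_apply, f.map_op, g.map_op]⟩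

end OrdAlg

/-- Terms over the signature `S` in the variables `x₀, x₁, x₂, …`. -/
inductive OrdTerm (S : ℕ → Type u) : Type u
  | var : ℕ → OrdTerm S
  | app : ∀ {n : ℕ}, S n → (Fin n → OrdTerm S) → OrdTerm S

/-- The value of a term in an algebra under an assignment of the variables. -/
def OrdTerm.eval {S : ℕ → Type u} (A : OrdAlg S) (x : ℕ → A.carrier) : OrdTerm S → A.carrier
  | .var i => x i
  | .app s t => A.op s (fun i => (t i).eval A x)

/-- `A` satisfies every inequation `s ≤ t` with `(s, t)` in the given set. -/
def Satisfies {S : ℕ → Type u} (I : Set (OrdTerm S × OrdTerm S)) : ObjectProperty (OrdAlg S) :=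
  fun A => ∀ p ∈ I, ∀ x : ℕ → A.carrier, p.1.eval A x ≤ p.2.eval A x

/-- The variety of ordered algebras over the signature `S` presented by the set `I` of
inequations: the full subcategory of the algebras which satisfy `I`. -/
abbrev Variety {S : ℕ → Type u} (I : Set (OrdTerm S × OrdTerm S)) : Type (u + 1) :=
  (Satisfies I).FullSubcategory

/-- Homomorphisms are ordered pointwise. -/
instance {S : ℕ → Type u} (I : Set (OrdTerm S × OrdTerm S)) : PosEnriched (Variety I) where
  homOrder A B := PartialOrder.lift (fun f : A ⟶ B => OrdAlg.Hom.toOrderHom f.hom)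
    (fun _ _ h => ObjectProperty.hom_ext _ (OrdAlg.Hom.ext h))
  comp_le_comp {_ _ _} {f _} {_ g'} hf hg := fun x =>
    (hg (OrdAlg.Hom.toOrderHom f.hom x)).trans ((OrdAlg.Hom.toOrderHom g'.hom).monotone (hf x))

/-- The forgetful functor of a variety, to its underlying posets. -/
def Variety.forget {S : ℕ → Type u} (I : Set (OrdTerm S × OrdTerm S)) :
    Variety I ⥤ PartOrd.{u} where
  obj A := PartOrd.of A.obj.carrier
  map f := PartOrd.ofHom (OrdAlg.Hom.toOrderHom f.hom)

/-- The concrete category `(K, U)` is (concretely) equivalent to a variety of ordered algebras: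
there is an enriched equivalence `E` from `K` to a variety which commutes with the forgetful
functors. -/
def IsEquivalentToVariety {K : Type w} [Category.{v} K] [PosEnriched K]
    (U : K ⥤ PartOrd.{u}) : Prop :=
  ∃ (S : ℕ → Type u) (I : Set (OrdTerm S × OrdTerm S)) (E : K ⥤ Variety I),
    IsPosEquivalence E ∧ U = E ⋙ Variety.forget I

end OrderedVarieties

/-!
A concrete category `(K, U)` is compared with the variety whose `n`-ary operation symbols are the
elements of `U (F n)`, where `F ⊣ U` and `n` is the discrete poset with `n` elements. An element `t`
of `U (F n)` acts on `U A` by sending a tuple `x : n ⟶ U A` to the value at `t` of its extension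
`U (F n) ⟶ U A`, and the inequations are all those which hold in every `U A`.

**From the properties to a variety.** Two facts carry the argument.

* Every element of `U (F X)` is the value of some `t` at a tuple of generators
  (`exists_map_tuple_eq`). Indeed `X` is the coinserter of a reflexive pair of discrete posets, a
  discrete poset is the filtered union of its finite subsets, and `U ∘ F` preserves both kinds of
  colimits; coinserters and colimit cocones of posets are (jointly) surjective.
* The counit `F (U A) ⟶ A` is split by the unit after applying `U`, hence it is a subregular
  epimorphism in `K`, hence the coinserter of its subkernel pair.

The second fact shows that `U` reflects the order of morphisms (`map_le_map_iff`), and together with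
the first one that every homomorphism `U A ⟶ U B` of algebras comes from a morphism of `K`
(`exists_comparison_map_eq`). For essential surjectivity, every monotone map from a poset `X` to an
algebra `A` of the variety extends to a homomorphism on `U (F X)` (`exists_extension`,
`extension_op`): for finite discrete `X` this is what the inequations say, and the two kinds of
colimits above give the general case. The extension of the identity of `A` is then a coinserter in
`Pos` of the image under `U` of a reflexive pair of morphisms between free objects, and the
coinserter of that pair in `K` is the required object (`exists_iso_comparison`).

**From a variety to the properties.** Reflexive coinserters, filtered colimits and free algebras of
a variety are all poset reflections of a set with operations which preserve a preorder (`PreAlg`).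
The first two are computed as in `Pos`, because reflexivity and filteredness make it possible to
treat the finitely many arguments of an operation simultaneously. A homomorphism is a subregular
epimorphism as soon as it is surjective. The properties are then transported along the enriched
equivalence.
-/

namespace OrderedVarieties

/-! ### Coinserters and subkernel pairs in categories enriched over posets -/

section Enriched

variable {K : Type w} [Category.{v} K] [PosEnriched K]

theorem comp_mono_left {X Y Z : K} {f f' : X ⟶ Y} (h : f ≤ f') (g : Y ⟶ Z) : f ≫ g ≤ f' ≫ g :=
  PosEnriched.comp_le_comp h le_rfl

theorem comp_mono_right {X Y Z : K} (f : X ⟶ Y) {g g' : Y ⟶ Z} (h : g ≤ g') : f ≫ g ≤ f ≫ g' :=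
  PosEnriched.comp_le_comp le_rfl h

theorem le_of_iso_comp_le {X Y Z : K} (e : X ≅ Y) {g g' : Y ⟶ Z} (h : e.hom ≫ g ≤ e.hom ≫ g') :
    g ≤ g' := by
  simpa using comp_mono_right e.inv h

theorem le_of_comp_iso_le {X Y Z : K} (e : Y ≅ Z) {g g' : X ⟶ Y} (h : g ≫ e.hom ≤ g' ≫ e.hom) :
    g ≤ g' := by
  simpa using comp_mono_left h e.inv

/-- Coinserters are order-epimorphisms, hence epimorphisms. -/
theorem IsCoinserter.cancel {V X Y Z : K} {u₀ u₁ : V ⟶ X} {f : X ⟶ Y} (hf : IsCoinserter u₀ u₁ f)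
    {g g' : Y ⟶ Z} (h : f ≫ g = f ≫ g') : g = g' :=
  le_antisymm (hf.le_of_comp_le _ _ h.le) (hf.le_of_comp_le _ _ h.ge)

/-- Two coinserters of the same pair have isomorphic codomains, compatibly with the projections. -/
theorem IsCoinserter.exists_iso {V X Y Y' : K} {u₀ u₁ : V ⟶ X} {f : X ⟶ Y} {f' : X ⟶ Y'}
    (hf : IsCoinserter u₀ u₁ f) (hf' : IsCoinserter u₀ u₁ f') : ∃ e : Y ≅ Y', f ≫ e.hom = f' := by
  obtain ⟨g, hg⟩ := hf.exists_desc f' hf'.condition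
  obtain ⟨g', hg'⟩ := hf'.exists_desc f hf.condition
  refine ⟨⟨g, g', hf.cancel ?_, hf'.cancel ?_⟩, hg⟩
  · rw [reassoc_of% hg, hg', Category.comp_id]
  · rw [reassoc_of% hg', hg, Category.comp_id]

theorem IsCoinserter.comp_iso {V X Y Y' : K} {u₀ u₁ : V ⟶ X} {f : X ⟶ Y}
    (hf : IsCoinserter u₀ u₁ f) (e : Y ≅ Y') : IsCoinserter u₀ u₁ (f ≫ e.hom) where
  condition := by simpa using comp_mono_left hf.condition e.hom
  exists_desc f' h := by
    obtain ⟨g, hg⟩ := hf.exists_desc f' h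
    exact ⟨e.inv ≫ g, by simpa using hg⟩
  le_of_comp_le g g' h := by
    refine le_of_iso_comp_le e (hf.le_of_comp_le _ _ ?_)
    simpa using h

theorem IsCoinserter.iso_comp {V V' X Y : K} {u₀ u₁ : V ⟶ X} {f : X ⟶ Y}
    (hf : IsCoinserter u₀ u₁ f) (e : V' ≅ V) : IsCoinserter (e.hom ≫ u₀) (e.hom ≫ u₁) f where
  condition := by simpa using comp_mono_right e.hom hf.condition
  exists_desc f' h := hf.exists_desc f' (le_of_iso_comp_le e (by simpa using h))
  le_of_comp_le := hf.le_of_comp_le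

theorem IsSubkernelPair.iso_comp {V V' X Y : K} {u₀ u₁ : V ⟶ X} {f : X ⟶ Y}
    (hf : IsSubkernelPair f u₀ u₁) (e : V' ≅ V) :
    IsSubkernelPair f (e.hom ≫ u₀) (e.hom ≫ u₁) where
  condition := by simpa using comp_mono_right e.hom hf.condition
  exists_lift v₀ v₁ h := by
    obtain ⟨k, h₀, h₁⟩ := hf.exists_lift v₀ v₁ h
    exact ⟨k ≫ e.inv, by simpa using h₀, by simpa using h₁⟩
  le_of_comp_le k k' h₀ h₁ :=
    le_of_comp_iso_le e (hf.le_of_comp_le _ _ (by simpa using h₀) (by simpa using h₁))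

/-- A subregular epimorphism is the coinserter of its subkernel pair. -/
theorem IsSubregularEpi.isCoinserter {V X Y : K} {u₀ u₁ : V ⟶ X} {f : X ⟶ Y}
    (hf : IsSubregularEpi f) (hu : IsSubkernelPair f u₀ u₁) : IsCoinserter u₀ u₁ f := by
  obtain ⟨W, v₀, v₁, hv⟩ := hf
  obtain ⟨k, rfl, rfl⟩ := hu.exists_lift v₀ v₁ hv.condition
  refine ⟨hu.condition, fun f' h => hv.exists_desc f' ?_, hv.le_of_comp_le⟩
  simpa using comp_mono_right k h

theorem IsConicalColimit.of_iso {J : Type w'} [Category.{v'} J] {D : J ⥤ K} {c c' : Cocone D}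
    (hc : IsConicalColimit c) (e : c ≅ c') : IsConicalColimit c' := by
  refine ⟨hc.1.map fun h => h.ofIsoColimit e, fun {X} f g h => ?_⟩
  refine le_of_iso_comp_le ((Cocone.forget _).mapIso e) (hc.2 _ _ fun j => ?_)
  have hw (k : c'.pt ⟶ X) : c.ι.app j ≫ e.hom.hom ≫ k = c'.ι.app j ≫ k :=
    (Category.assoc _ _ _).symm.trans (congrArg (· ≫ k) (e.hom.w j))
  exact (hw f).le.trans ((h j).trans (hw g).ge)

end Enriched

section Adjunction

variable {K : Type w} [Category.{v} K] [PosEnriched K] {L : Type w'} [Category.{v'} L]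
  [PosEnriched L] {F : L ⥤ K} {U : K ⥤ L}

/-- The bijection between hom-sets of an enriched adjunction is an isomorphism of posets. -/
theorem homEquiv_le_iff (adj : F ⊣ U) (hF : IsPosFunctor F) (hU : IsPosFunctor U) {X : L} {A : K}
    {f g : F.obj X ⟶ A} : adj.homEquiv X A f ≤ adj.homEquiv X A g ↔ f ≤ g := by
  refine ⟨fun h => ?_, fun h => ?_⟩
  · have e (f : F.obj X ⟶ A) : F.map (adj.homEquiv X A f) ≫ adj.counit.app A = f :=
      (adj.homEquiv_counit _ _ _).symm.trans (Equiv.symm_apply_apply _ _)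
    simpa only [e] using comp_mono_left (hF h) (adj.counit.app A)
  · rw [adj.homEquiv_unit, adj.homEquiv_unit]
    exact comp_mono_right _ (hU h)

/-- An enriched left adjoint preserves coinserters. -/
theorem IsCoinserter.map_leftAdjoint (adj : F ⊣ U) (hF : IsPosFunctor F) (hU : IsPosFunctor U)
    {V X Y : L} {u₀ u₁ : V ⟶ X} {f : X ⟶ Y} (hf : IsCoinserter u₀ u₁ f) :
    IsCoinserter (F.map u₀) (F.map u₁) (F.map f) where
  condition := by simpa using hF hf.condition
  exists_desc {Z} f' h := by
    rw [← homEquiv_le_iff adj hF hU, adj.homEquiv_naturality_left,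
      adj.homEquiv_naturality_left] at h
    obtain ⟨g, hg⟩ := hf.exists_desc _ h
    refine ⟨(adj.homEquiv _ _).symm g, ?_⟩
    rw [← adj.homEquiv_naturality_left_symm, hg, Equiv.symm_apply_apply]
  le_of_comp_le {Z} g g' h := by
    rw [← homEquiv_le_iff adj hF hU, adj.homEquiv_naturality_left,
      adj.homEquiv_naturality_left] at h
    exact (homEquiv_le_iff adj hF hU).1 (hf.le_of_comp_le _ _ h)

/-- An enriched left adjoint preserves conical colimits. -/
theorem IsConicalColimit.map_leftAdjoint (adj : F ⊣ U) (hF : IsPosFunctor F) (hU : IsPosFunctor U)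
    {J : Type*} [Category* J] {D : J ⥤ L} {c : Cocone D} (hc : IsConicalColimit c) :
    IsConicalColimit (F.mapCocone c) := by
  have := adj.leftAdjoint_preservesColimits
  refine ⟨hc.1.map fun h => isColimitOfPreserves F h, fun {X} f g h => ?_⟩
  refine (homEquiv_le_iff adj hF hU).1 (hc.2 _ _ fun j => ?_)
  have e (f : F.obj c.pt ⟶ X) := adj.homEquiv_naturality_left (c.ι.app j) f
  exact (e f).symm.le.trans (((homEquiv_le_iff adj hF hU).2 (h j)).trans (e g).le)

end Adjunction

/-! ### Coinserters and conical colimits of posets -/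

section Posets

theorem PartOrd.le_iff {X Y : PartOrd.{u}} {f g : X ⟶ Y} : f ≤ g ↔ ∀ x, f x ≤ g x := Iff.rfl

/-- A family of monotone maps into `Y` is jointly surjective if only the identity of `Y` fixes it,
and if its corestriction to each subposet that contains its image extends along it to `Y`: apply
this to the union of the images. -/
theorem exists_apply_eq_of_forall_desc {Y : PartOrd.{u}} {ι : Type*} {X : ι → PartOrd.{u}}
    (f : ∀ i, X i ⟶ Y)
    (hepi : ∀ g : Y ⟶ Y, (∀ i, f i ≫ g = f i) → g = 𝟙 Y)
    (hdesc : ∀ (Z : Set Y) (f' : ∀ i, X i ⟶ PartOrd.of Z), (∀ i x, (f' i x : Y) = f i x) →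
      ∃ g : Y ⟶ PartOrd.of Z, ∀ i, f i ≫ g = f' i) (y : Y) : ∃ i x, f i x = y := by
  let Z : Set Y := {y | ∃ i x, f i x = y}
  let f' : ∀ i, X i ⟶ PartOrd.of Z := fun i =>
    PartOrd.ofHom ⟨fun x => ⟨f i x, i, x, rfl⟩, fun _ _ h => (f i).hom.monotone h⟩
  obtain ⟨g, hg⟩ := hdesc Z f' fun _ _ => rfl
  let j : PartOrd.of Z ⟶ Y := PartOrd.ofHom ⟨Subtype.val, fun _ _ h => h⟩
  have h : g ≫ j = 𝟙 Y := hepi _ fun i => by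
    rw [← Category.assoc, hg]
    rfl
  have hy : ((g y : Z) : Y) = y := congrArg (fun k : Y ⟶ Y => k y) h
  rw [← hy]
  exact (g y : Z).2

theorem IsCoinserter.surjective {V X Y : PartOrd.{u}} {u₀ u₁ : V ⟶ X} {f : X ⟶ Y}
    (hf : IsCoinserter u₀ u₁ f) : Function.Surjective f := fun y => by
  obtain ⟨-, x, hx⟩ := exists_apply_eq_of_forall_desc (ι := Unit) (fun _ => f)
    (fun g hg => hf.cancel (by simpa using hg ()))
    (fun Z f' hf' => by
      obtain ⟨g, hg⟩ := hf.exists_desc (f' ()) fun v => by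
        change (f' () (u₀ v) : Y) ≤ f' () (u₁ v)
        rw [hf', hf']
        exact hf.condition v
      exact ⟨g, fun _ => hg⟩) y
  exact ⟨x, hx⟩

/-- The colimit cocone of a conical colimit of posets is jointly surjective. -/
theorem IsConicalColimit.exists_apply_eq {J : Type w'} [Category.{v'} J] {D : J ⥤ PartOrd.{u}}
    {c : Cocone D} (hc : IsConicalColimit c) (y : c.pt) : ∃ j x, c.ι.app j x = y := by
  obtain ⟨h⟩ := hc.1
  refine exists_apply_eq_of_forall_desc (fun j => c.ι.app j)
    (fun g hg => h.hom_ext fun j => by simpa using hg j) (fun Z f' hf' => ?_) y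
  let s : Cocone D := ⟨PartOrd.of Z, ⟨f', fun i j k => by
    ext x
    refine Subtype.ext ?_
    change (f' j (D.map k x) : c.pt) = f' i x
    rw [hf', hf', ← c.w k]
    rfl⟩⟩
  exact ⟨h.desc s, fun j => h.fac s j⟩

/-- A monotone map out of `X` factors through a surjection `X ⟶ Y` as soon as it is monotone for
the preorder that the surjection induces on `X`. -/
theorem exists_comp_eq_of_surjective {X Y Z : PartOrd.{u}} (f : X ⟶ Y) (hf : Function.Surjective f)
    (f' : X ⟶ Z) (h : ∀ x x', f x ≤ f x' → f' x ≤ f' x') : ∃ g : Y ⟶ Z, f ≫ g = f' := by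
  refine ⟨PartOrd.ofHom ⟨fun y => f' (hf y).choose, fun y y' hy => h _ _ ?_⟩, ?_⟩
  · rw [(hf y).choose_spec, (hf y').choose_spec]
    exact hy
  · ext x
    exact le_antisymm (h _ _ (hf (f x)).choose_spec.le) (h _ _ (hf (f x)).choose_spec.ge)

theorem isCoinserter_of_surjective {V X Y : PartOrd.{u}} {u₀ u₁ : V ⟶ X} {f : X ⟶ Y}
    (hf : Function.Surjective f) (hc : ∀ v, f (u₀ v) ≤ f (u₁ v))
    (h : ∀ {Z : PartOrd.{u}} (f' : X ⟶ Z), (∀ v, f' (u₀ v) ≤ f' (u₁ v)) →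
      ∀ x x', f x ≤ f x' → f' x ≤ f' x') : IsCoinserter u₀ u₁ f where
  condition := hc
  exists_desc f' hf' := exists_comp_eq_of_surjective f hf f' (h f' hf')
  le_of_comp_le g g' hg := fun y => by
    obtain ⟨x, rfl⟩ := hf y
    exact hg x

/-- Split epimorphisms of posets are subregular. -/
theorem isSubregularEpi_of_section {X Y : PartOrd.{u}} (f : X ⟶ Y) (s : Y ⟶ X)
    (hs : s ≫ f = 𝟙 Y) : IsSubregularEpi f := by
  have hs' : ∀ y, f (s y) = y := fun y => congrArg (fun k : Y ⟶ Y => k y) hs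
  let V : PartOrd.{u} := PartOrd.of {p : X × X // f p.1 ≤ f p.2}
  let u₀ : V ⟶ X := PartOrd.ofHom ⟨fun p => p.1.1, fun _ _ h => h.1⟩
  let u₁ : V ⟶ X := PartOrd.ofHom ⟨fun p => p.1.2, fun _ _ h => h.2⟩
  exact ⟨V, u₀, u₁, isCoinserter_of_surjective (fun y => ⟨s y, hs' y⟩) (fun p => p.2)
    fun f' hf' x x' h => hf' ⟨(x, x'), h⟩⟩

end Posets

/-! ### Homomorphisms and quotients of ordered algebras -/

theorem OrdTerm.eval_map {S : ℕ → Type u} {A B : OrdAlg S} (f : A.carrier → B.carrier)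
    (hf : ∀ {n : ℕ} (s : S n) (x : Fin n → A.carrier), f (A.op s x) = B.op s (fun i => f (x i)))
    (x : ℕ → A.carrier) (t : OrdTerm S) : t.eval B (fun i => f (x i)) = f (t.eval A x) := by
  induction t with
  | var i => rfl
  | app s t ih => simp only [OrdTerm.eval, hf, ih]

/-- The value of a term depends on finitely many variables only. -/
theorem OrdTerm.exists_eval_congr {S : ℕ → Type u} (t : OrdTerm S) :
    ∃ N : ℕ, ∀ (A : OrdAlg S) (x y : ℕ → A.carrier), (∀ i < N, x i = y i) →
      t.eval A x = t.eval A y := by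
  induction t with
  | var i => exact ⟨i + 1, fun A x y h => h i i.lt_succ_self⟩
  | @app n s t ih =>
    choose N hN using ih
    refine ⟨Finset.univ.sup N, fun A x y h => ?_⟩
    simp only [OrdTerm.eval]
    congr 1
    funext i
    exact hN i A x y fun k hk => h k (hk.trans_le (Finset.le_sup (Finset.mem_univ i)))

/-- A set with operations and a preorder which the operations preserve. Its poset reflection is
an ordered algebra. -/
structure PreAlg (S : ℕ → Type u) where
  carrier : Type u
  rel : carrier → carrier → Prop
  rel_refl : ∀ a, rel a a
  rel_trans : ∀ {a b c}, rel a b → rel b c → rel a c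
  op : ∀ {n : ℕ}, S n → (Fin n → carrier) → carrier
  op_rel : ∀ {n : ℕ} (s : S n) {x y : Fin n → carrier}, (∀ i, rel (x i) (y i)) →
    rel (op s x) (op s y)

namespace PreAlg

variable {S : ℕ → Type u} (P : PreAlg S)

/-- The preorder of a `PreAlg`. -/
@[reducible]
def preorder : Preorder P.carrier where
  le := P.rel
  le_refl := P.rel_refl
  le_trans _ _ _ := P.rel_trans

/-- The poset reflection of `P`. -/
def Quot : Type u :=
  letI := P.preorder
  Antisymmetrization P.carrier (· ≤ ·)

instance : PartialOrder P.Quot :=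
  @instPartialOrderAntisymmetrization P.carrier P.preorder

/-- The projection to the poset reflection. -/
def proj (a : P.carrier) : P.Quot :=
  letI := P.preorder
  toAntisymmetrization (· ≤ ·) a

variable {P}

theorem proj_le_proj {a b : P.carrier} : P.proj a ≤ P.proj b ↔ P.rel a b := Iff.rfl

theorem proj_surjective : Function.Surjective P.proj := Quotient.mk_surjective

theorem proj_eq_proj {a b : P.carrier} (h : P.rel a b) (h' : P.rel b a) : P.proj a = P.proj b :=
  le_antisymm (proj_le_proj.2 h) (proj_le_proj.2 h')

variable (P) in
/-- The poset reflection of `P`, with the induced operations. -/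
noncomputable abbrev quot : OrdAlg S where
  carrier := P.Quot
  op s x := P.proj (P.op s fun i => (proj_surjective (x i)).choose)
  op_mono s x y h := proj_le_proj.2 (P.op_rel s fun i => proj_le_proj.1 <| by
    rw [(proj_surjective (x i)).choose_spec, (proj_surjective (y i)).choose_spec]
    exact h i)

theorem op_proj {n : ℕ} (s : S n) (x : Fin n → P.carrier) :
    P.quot.op s (fun i => P.proj (x i)) = P.proj (P.op s x) :=
  proj_eq_proj
    (P.op_rel s fun i => proj_le_proj.1 (proj_surjective (P.proj (x i))).choose_spec.le)
    (P.op_rel s fun i => proj_le_proj.1 (proj_surjective (P.proj (x i))).choose_spec.ge)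

/-- A monotone map out of the poset reflection. -/
noncomputable def liftOrderHom {Y : Type*} [PartialOrder Y] (g : P.carrier → Y)
    (hg : ∀ {a b}, P.rel a b → g a ≤ g b) : P.Quot →o Y where
  toFun q := g (proj_surjective q).choose
  monotone' q q' h := hg <| proj_le_proj.1 <| by
    rwa [(proj_surjective q).choose_spec, (proj_surjective q').choose_spec]

@[simp]
theorem liftOrderHom_proj {Y : Type*} [PartialOrder Y] (g : P.carrier → Y)
    (hg : ∀ {a b}, P.rel a b → g a ≤ g b) (a : P.carrier) : liftOrderHom g hg (P.proj a) = g a :=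
  le_antisymm (hg (proj_le_proj.1 (proj_surjective (P.proj a)).choose_spec.le))
    (hg (proj_le_proj.1 (proj_surjective (P.proj a)).choose_spec.ge))

end PreAlg

namespace Variety

variable {S : ℕ → Type u} {I : Set (OrdTerm S × OrdTerm S)}

/-- The monotone map underlying a homomorphism. -/
def orderHom {A B : Variety I} (f : A ⟶ B) : A.obj.carrier →o B.obj.carrier :=
  OrdAlg.Hom.toOrderHom f.hom

theorem orderHom_op {A B : Variety I} (f : A ⟶ B) {n : ℕ} (s : S n)
    (x : Fin n → A.obj.carrier) :
    orderHom f (A.obj.op s x) = B.obj.op s (fun i => orderHom f (x i)) :=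
  OrdAlg.Hom.map_op f.hom s x

@[simp]
theorem orderHom_comp {A B C : Variety I} (f : A ⟶ B) (g : B ⟶ C) (a : A.obj.carrier) :
    orderHom (f ≫ g) a = orderHom g (orderHom f a) := rfl

@[simp]
theorem orderHom_id (A : Variety I) (a : A.obj.carrier) : orderHom (𝟙 A) a = a := rfl

theorem le_iff {A B : Variety I} {f g : A ⟶ B} : f ≤ g ↔ ∀ a, orderHom f a ≤ orderHom g a :=
  Iff.rfl

theorem hom_ext {A B : Variety I} {f g : A ⟶ B} (h : ∀ a, orderHom f a = orderHom g a) : f = g :=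
  ObjectProperty.hom_ext _ (OrdAlg.Hom.ext (OrderHom.ext _ _ (funext h)))

/-- A morphism of a variety from a monotone map which preserves the operations. -/
def mkHom {A B : Variety I} (f : A.obj.carrier →o B.obj.carrier)
    (hf : ∀ {n : ℕ} (s : S n) (x : Fin n → A.obj.carrier),
      f (A.obj.op s x) = B.obj.op s (fun i => f (x i))) : A ⟶ B :=
  ObjectProperty.homMk ⟨f, hf⟩

/-- A morphism of a poset reflection into an algebra of the variety. -/
noncomputable def liftHom {P : PreAlg S} {hP : Satisfies I P.quot} {B : Variety I}
    (g : P.carrier → B.obj.carrier) (hg : ∀ {a b}, P.rel a b → g a ≤ g b)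
    (hop : ∀ {n : ℕ} (s : S n) (x : Fin n → P.carrier),
      g (P.op s x) = B.obj.op s (fun i => g (x i))) :
    (⟨P.quot, hP⟩ : Variety I) ⟶ B :=
  mkHom (A := ⟨P.quot, hP⟩) (PreAlg.liftOrderHom g hg) fun {n} s x => by
    choose y hy using fun i => PreAlg.proj_surjective (x i)
    obtain rfl : (fun i => P.proj (y i)) = x := funext hy
    change PreAlg.liftOrderHom g hg (P.quot.op s fun i => P.proj (y i)) = _
    rw [PreAlg.op_proj]
    rw [PreAlg.liftOrderHom_proj, hop]
    exact congrArg _ (funext fun i => (PreAlg.liftOrderHom_proj g hg (y i)).symm)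

@[simp]
theorem liftHom_proj {P : PreAlg S} {hP : Satisfies I P.quot} {B : Variety I}
    (g : P.carrier → B.obj.carrier) (hg : ∀ {a b}, P.rel a b → g a ≤ g b)
    (hop : ∀ {n : ℕ} (s : S n) (x : Fin n → P.carrier),
      g (P.op s x) = B.obj.op s (fun i => g (x i))) (a : P.carrier) :
    orderHom (liftHom (hP := hP) g hg hop) (P.proj a) = g a :=
  PreAlg.liftOrderHom_proj g hg a

/-! ### Subkernel pairs and subregular epimorphisms in a variety -/

/-- The subalgebra of `A × A` formed by the pairs `(x, y)` with `f x ≤ f y`. -/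
def subkernel {A B : Variety I} (f : A ⟶ B) : Variety I where
  obj :=
    { carrier := {p : A.obj.carrier × A.obj.carrier // orderHom f p.1 ≤ orderHom f p.2}
      op := fun s x => ⟨(A.obj.op s fun i => (x i).1.1, A.obj.op s fun i => (x i).1.2), by
        simp only [orderHom_op]
        exact B.obj.op_mono s fun i => (x i).2⟩
      op_mono := fun s _ _ h => Subtype.mk_le_mk.2
        ⟨A.obj.op_mono s fun i => (h i).1, A.obj.op_mono s fun i => (h i).2⟩ }
  property p hp x := by
    refine ⟨?_, ?_⟩
    · have h := A.property p hp fun i => (x i).1.1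
      rwa [OrdTerm.eval_map (fun a : {p : A.obj.carrier × A.obj.carrier //
          orderHom f p.1 ≤ orderHom f p.2} => a.1.1) (fun _ _ => rfl) x p.1,
        OrdTerm.eval_map (fun a : {p : A.obj.carrier × A.obj.carrier //
          orderHom f p.1 ≤ orderHom f p.2} => a.1.1) (fun _ _ => rfl) x p.2] at h
    · have h := A.property p hp fun i => (x i).1.2
      rwa [OrdTerm.eval_map (fun a : {p : A.obj.carrier × A.obj.carrier //
          orderHom f p.1 ≤ orderHom f p.2} => a.1.2) (fun _ _ => rfl) x p.1,
        OrdTerm.eval_map (fun a : {p : A.obj.carrier × A.obj.carrier //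
          orderHom f p.1 ≤ orderHom f p.2} => a.1.2) (fun _ _ => rfl) x p.2] at h

/-- The first projection of the subkernel. -/
def subkernelFst {A B : Variety I} (f : A ⟶ B) : subkernel f ⟶ A :=
  mkHom (A := subkernel f) ⟨fun p => p.1.1, fun _ _ h => h.1⟩ fun _ _ => rfl

/-- The second projection of the subkernel. -/
def subkernelSnd {A B : Variety I} (f : A ⟶ B) : subkernel f ⟶ A :=
  mkHom (A := subkernel f) ⟨fun p => p.1.2, fun _ _ h => h.2⟩ fun _ _ => rfl

theorem isSubkernelPair_subkernel {A B : Variety I} (f : A ⟶ B) :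
    IsSubkernelPair f (subkernelFst f) (subkernelSnd f) where
  condition := fun p => p.2
  exists_lift v₀ v₁ h :=
    ⟨mkHom (B := subkernel f) ⟨fun a => ⟨(orderHom v₀ a, orderHom v₁ a), h a⟩,
      fun _ _ h => ⟨(orderHom v₀).monotone h, (orderHom v₁).monotone h⟩⟩
      fun s x => Subtype.ext (Prod.ext (orderHom_op v₀ s x) (orderHom_op v₁ s x)), rfl, rfl⟩
  le_of_comp_le _ _ h₀ h₁ := fun a => ⟨h₀ a, h₁ a⟩

variable (I) in
theorem hasSubkernelPairs : HasSubkernelPairs (Variety I) := fun _ _ f =>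
  ⟨_, _, _, isSubkernelPair_subkernel f⟩

/-- A homomorphism out of `A` factors through a surjective one as soon as it is monotone for the
preorder which the latter induces on `A`. -/
theorem exists_comp_eq_of_surjective {A B C : Variety I} (f : A ⟶ B)
    (hf : Function.Surjective (orderHom f)) (f' : A ⟶ C)
    (h : ∀ a a', orderHom f a ≤ orderHom f a' → orderHom f' a ≤ orderHom f' a') :
    ∃ g : B ⟶ C, f ≫ g = f' := by
  obtain ⟨g, hg⟩ := OrderedVarieties.exists_comp_eq_of_surjective ((forget I).map f) hf
    ((forget I).map f') h
  have hg' : ∀ a, g (orderHom f a) = orderHom f' a := fun a =>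
    congrArg (fun k : (forget I).obj A ⟶ (forget I).obj C => k a) hg
  refine ⟨mkHom g.hom fun s x => ?_, hom_ext hg'⟩
  choose y hy using fun i => hf (x i)
  obtain rfl : (fun i => orderHom f (y i)) = x := funext hy
  rw [← orderHom_op]
  refine (hg' _).trans ((orderHom_op _ _ _).trans (congrArg _ (funext fun i => (hg' _).symm)))

theorem isCoinserter_of_surjective {V A B : Variety I} {u₀ u₁ : V ⟶ A} {f : A ⟶ B}
    (hf : Function.Surjective (orderHom f)) (hc : u₀ ≫ f ≤ u₁ ≫ f)
    (h : ∀ {C : Variety I} (f' : A ⟶ C), u₀ ≫ f' ≤ u₁ ≫ f' →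
      ∀ a a', orderHom f a ≤ orderHom f a' → orderHom f' a ≤ orderHom f' a') :
    IsCoinserter u₀ u₁ f where
  condition := hc
  exists_desc f' hf' := exists_comp_eq_of_surjective f hf f' (h f' hf')
  le_of_comp_le g g' hg := fun b => by
    obtain ⟨a, rfl⟩ := hf b
    exact hg a

theorem isSubregularEpi_of_surjective {A B : Variety I} {f : A ⟶ B}
    (hf : Function.Surjective (orderHom f)) : IsSubregularEpi f :=
  ⟨_, _, _, isCoinserter_of_surjective hf (isSubkernelPair_subkernel f).condition
    fun _ hf' a a' h => hf' ⟨(a, a'), h⟩⟩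

variable (I) in
theorem reflectsSubregularEpis : ReflectsSubregularEpis (forget I) := fun _ _ _ ⟨_, _, _, h⟩ =>
  isSubregularEpi_of_surjective h.surjective

theorem satisfies_of_surjective {A : Variety I} {B : OrdAlg S} (f : A.obj.carrier →o B.carrier)
    (hf : ∀ {n : ℕ} (s : S n) (x : Fin n → A.obj.carrier),
      f (A.obj.op s x) = B.op s (fun i => f (x i)))
    (hs : Function.Surjective f) : Satisfies I B := fun p hp x => by
  choose y hy using fun i => hs (x i)
  obtain rfl : (fun i => f (y i)) = x := funext hy
  rw [OrdTerm.eval_map f hf, OrdTerm.eval_map f hf]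
  exact f.monotone (A.property p hp y)

/-! ### Reflexive coinserters in a variety -/

/-- The preorder on `A` which the coinserter of the pair `u₀, u₁` induces is the transitive closure
of this relation, provided that the pair is reflexive. -/
def CoinserterRel {V A : Variety I} (u₀ u₁ : V ⟶ A) (a b : A.obj.carrier) : Prop :=
  ∃ v, a ≤ orderHom u₀ v ∧ orderHom u₁ v ≤ b

theorem CoinserterRel.op {V A : Variety I} {u₀ u₁ : V ⟶ A} {n : ℕ} (s : S n)
    {x y : Fin n → A.obj.carrier} (h : ∀ i, CoinserterRel u₀ u₁ (x i) (y i)) :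
    CoinserterRel u₀ u₁ (A.obj.op s x) (A.obj.op s y) := by
  choose v h₀ h₁ using h
  refine ⟨V.obj.op s v, ?_, ?_⟩
  · rw [orderHom_op]
    exact A.obj.op_mono s h₀
  · rw [orderHom_op]
    exact A.obj.op_mono s h₁

/-- Reflexivity of the relation makes it possible to change the arguments of an operation one at
a time. -/
theorem transGen_coinserterRel_op {V A : Variety I} {u₀ u₁ : V ⟶ A}
    (hr : ∀ a, CoinserterRel u₀ u₁ a a) {n : ℕ} (s : S n) {x y : Fin n → A.obj.carrier}
    (h : ∀ i, Relation.TransGen (CoinserterRel u₀ u₁) (x i) (y i)) :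
    Relation.TransGen (CoinserterRel u₀ u₁) (A.obj.op s x) (A.obj.op s y) := by
  classical
  suffices H : ∀ T : Finset (Fin n), Relation.TransGen (CoinserterRel u₀ u₁) (A.obj.op s x)
      (A.obj.op s (T.piecewise y x)) by
    simpa using H Finset.univ
  intro T
  induction T using Finset.induction_on with
  | empty => simpa using Relation.TransGen.single (hr _)
  | insert j T hj ih =>
    refine ih.trans ?_
    rw [Finset.piecewise_insert]
    have hx : T.piecewise y x = Function.update (T.piecewise y x) j (x j) := by
      rw [Function.eq_update_iff]
      simp [hj]
    conv => enter [2]; rw [hx]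
    refine (h j).lift (fun a => A.obj.op s (Function.update (T.piecewise y x) j a))
      fun a b hab => CoinserterRel.op s fun i => ?_
    obtain rfl | hi := eq_or_ne i j
    · simpa using hab
    · simpa [hi] using hr _

theorem le_of_transGen_coinserterRel {V A : Variety I} {u₀ u₁ : V ⟶ A} {Y : Type*}
    [PartialOrder Y] {g : A.obj.carrier → Y} (hg : Monotone g)
    (h : ∀ v, g (orderHom u₀ v) ≤ g (orderHom u₁ v)) {a b : A.obj.carrier}
    (hab : Relation.TransGen (CoinserterRel u₀ u₁) a b) : g a ≤ g b := by
  have H : ∀ {a b}, CoinserterRel u₀ u₁ a b → g a ≤ g b := fun ⟨v, h₀, h₁⟩ =>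
    (hg h₀).trans ((h v).trans (hg h₁))
  induction hab with
  | single h => exact H h
  | tail _ h ih => exact ih.trans (H h)

/-- Reflexive pairs in a variety have a coinserter which the forgetful functor preserves. -/
theorem exists_coinserter {V A : Variety I} {u₀ u₁ : V ⟶ A} (hu : IsReflexivePos u₀ u₁) :
    ∃ (B : Variety I) (f : A ⟶ B), IsCoinserter u₀ u₁ f ∧
      IsCoinserter ((forget I).map u₀) ((forget I).map u₁) ((forget I).map f) := by
  obtain ⟨d, hd₀, hd₁⟩ := hu
  have hd₀' (a) : orderHom u₀ (orderHom d a) = a := congrArg (fun k : A ⟶ A => orderHom k a) hd₀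
  have hd₁' (a) : orderHom u₁ (orderHom d a) = a := congrArg (fun k : A ⟶ A => orderHom k a) hd₁
  have hle {a b : A.obj.carrier} (h : a ≤ b) : CoinserterRel u₀ u₁ a b :=
    ⟨orderHom d b, by rwa [hd₀'], by rw [hd₁']⟩
  let P : PreAlg S :=
    { carrier := A.obj.carrier
      rel := Relation.TransGen (CoinserterRel u₀ u₁)
      rel_refl := fun a => .single (hle le_rfl)
      rel_trans := .trans
      op := A.obj.op
      op_rel := fun s _ _ h => transGen_coinserterRel_op (fun a => hle le_rfl) s h }
  let p : A.obj.carrier →o P.quot.carrier := ⟨P.proj, fun _ _ h => .single (hle h)⟩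
  have hp {n : ℕ} (s : S n) (x : Fin n → A.obj.carrier) :
      p (A.obj.op s x) = P.quot.op s (fun i => p (x i)) := (PreAlg.op_proj (P := P) s x).symm
  have hc (v) : p (orderHom u₀ v) ≤ p (orderHom u₁ v) := .single ⟨v, le_rfl, le_rfl⟩
  let B : Variety I := ⟨P.quot, satisfies_of_surjective p hp PreAlg.proj_surjective⟩
  refine ⟨B, mkHom (B := B) p hp, isCoinserter_of_surjective PreAlg.proj_surjective hc ?_,
    OrderedVarieties.isCoinserter_of_surjective PreAlg.proj_surjective hc ?_⟩
  · exact fun f' hf' a a' h => le_of_transGen_coinserterRel (orderHom f').monotone hf' h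
  · exact fun f' hf' a a' h => le_of_transGen_coinserterRel f'.hom.monotone hf' h

variable (I) in
theorem hasReflexiveCoinserters : HasReflexiveCoinserters (Variety I) := fun _ _ _ _ hu =>
  let ⟨B, f, hf, _⟩ := exists_coinserter hu
  ⟨B, f, hf⟩

variable (I) in
theorem preservesReflexiveCoinserters : PreservesReflexiveCoinserters (forget I) := by
  intro V A B u₀ u₁ f hu hf
  obtain ⟨B', f', hf', hU⟩ := exists_coinserter hu
  obtain ⟨e, rfl⟩ := hf'.exists_iso hf
  simpa using hU.comp_iso ((forget I).mapIso e)

end Variety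

/-! ### Free algebras of a variety -/

/-- Terms over the signature `S` with variables from `X`. -/
inductive FreeTerm (S : ℕ → Type u) (X : Type u) : Type u
  | of : X → FreeTerm S X
  | app : ∀ {n : ℕ}, S n → (Fin n → FreeTerm S X) → FreeTerm S X

namespace FreeTerm

variable {S : ℕ → Type u} {X : Type u}

/-- The value of a term in an algebra under an assignment of the variables. -/
def eval (A : OrdAlg S) (h : X → A.carrier) : FreeTerm S X → A.carrier
  | .of x => h x
  | .app s t => A.op s (fun i => (t i).eval A h)

/-- Substitution of terms for the variables. -/
def subst (y : ℕ → FreeTerm S X) : OrdTerm S → FreeTerm S X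
  | .var i => y i
  | .app s t => .app s (fun i => subst y (t i))

theorem eval_subst (A : OrdAlg S) (h : X → A.carrier) (y : ℕ → FreeTerm S X) (t : OrdTerm S) :
    (subst y t).eval A h = t.eval A (fun i => (y i).eval A h) := by
  induction t with
  | var i => rfl
  | app s t ih => simp only [subst, eval, OrdTerm.eval, ih]

theorem eval_mono (A : OrdAlg S) {h h' : X → A.carrier} (hh : ∀ x, h x ≤ h' x)
    (t : FreeTerm S X) : t.eval A h ≤ t.eval A h' := by
  induction t with
  | of x => exact hh x
  | app s t ih => exact A.op_mono s ih

end FreeTerm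

namespace Variety

variable {S : ℕ → Type u} (I : Set (OrdTerm S × OrdTerm S))

/-- The terms with variables from a poset `X`, preordered by the validity of inequations in all
algebras of the variety, under all monotone assignments. -/
abbrev freePreAlg (X : Type u) [PartialOrder X] : PreAlg S where
  carrier := FreeTerm S X
  rel a b := ∀ (A : Variety I) (h : X →o A.obj.carrier), a.eval A.obj h ≤ b.eval A.obj h
  rel_refl _ _ _ := le_rfl
  rel_trans h h' A k := (h A k).trans (h' A k)
  op := .app
  op_rel s _ _ h A k := A.obj.op_mono s fun i => h i A k

theorem eval_freePreAlg {X : Type u} [PartialOrder X] (y : ℕ → FreeTerm S X) (t : OrdTerm S) :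
    t.eval (freePreAlg I X).quot (fun i => (freePreAlg I X).proj (y i)) =
      (freePreAlg I X).proj (FreeTerm.subst y t) := by
  induction t with
  | var i => rfl
  | app s t ih =>
    simp only [OrdTerm.eval, ih]
    exact PreAlg.op_proj (P := freePreAlg I X) s _

theorem satisfies_freePreAlg (X : Type u) [PartialOrder X] :
    Satisfies I (freePreAlg I X).quot := fun p hp x => by
  choose y hy using fun i => PreAlg.proj_surjective (x i)
  obtain rfl : (fun i => (freePreAlg I X).proj (y i)) = x := funext hy
  rw [eval_freePreAlg, eval_freePreAlg]
  refine PreAlg.proj_le_proj.2 fun A h => ?_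
  rw [FreeTerm.eval_subst, FreeTerm.eval_subst]
  exact A.property p hp _

/-- The free algebra of the variety on a poset. -/
noncomputable def free (X : PartOrd.{u}) : Variety I :=
  ⟨(freePreAlg I X).quot, satisfies_freePreAlg I X⟩

variable {I}

/-- The insertion of the generators. -/
def freeUnit (X : PartOrd.{u}) : X →o (free I X).obj.carrier where
  toFun x := (freePreAlg I X).proj (.of x)
  monotone' _ _ h := PreAlg.proj_le_proj.2 fun _ k => k.monotone h

/-- The extension of a monotone map to a homomorphism on the free algebra. -/
noncomputable def freeLift {X : PartOrd.{u}} {A : Variety I} (h : X →o A.obj.carrier) :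
    free I X ⟶ A :=
  liftHom (P := freePreAlg I X) (FreeTerm.eval A.obj h) (fun hab => hab A h) fun _ _ => rfl

theorem orderHom_freeLift {X : PartOrd.{u}} {A : Variety I} (h : X →o A.obj.carrier)
    (t : FreeTerm S X) :
    orderHom (freeLift h) ((freePreAlg I X).proj t) = t.eval A.obj h :=
  liftHom_proj (P := freePreAlg I X) (FreeTerm.eval A.obj h) (fun hab => hab A h)
    (fun _ _ => rfl) t

theorem orderHom_free_proj {X : PartOrd.{u}} {A : Variety I} (f : free I X ⟶ A)
    (t : FreeTerm S X) :
    orderHom f ((freePreAlg I X).proj t) = t.eval A.obj fun x => orderHom f (freeUnit X x) := by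
  induction t with
  | of x => rfl
  | app s t ih =>
    refine (congrArg _ (PreAlg.op_proj (P := freePreAlg I X) s t).symm).trans ?_
    refine (orderHom_op f s _).trans ?_
    simp only [FreeTerm.eval, ih]

/-- The universal property of the free algebra. -/
noncomputable def freeHomEquiv (X : PartOrd.{u}) (A : Variety I) :
    (free I X ⟶ A) ≃ (X ⟶ (forget I).obj A) where
  toFun f := PartOrd.ofHom (Y := A.obj.carrier) ((orderHom f).comp (freeUnit X))
  invFun h := freeLift h.hom
  left_inv f := hom_ext fun a => by
    obtain ⟨t, rfl⟩ := PreAlg.proj_surjective a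
    exact (orderHom_freeLift _ t).trans (orderHom_free_proj f t).symm
  right_inv h := by
    ext x
    exact orderHom_freeLift h.hom (.of x)

theorem freeHomEquiv_symm_mono {X : PartOrd.{u}} {A : Variety I} {h h' : X ⟶ (forget I).obj A}
    (hh : h ≤ h') : (freeHomEquiv X A).symm h ≤ (freeHomEquiv X A).symm h' := fun a => by
  obtain ⟨t, rfl⟩ := PreAlg.proj_surjective a
  exact (orderHom_freeLift h.hom t).le.trans
    ((FreeTerm.eval_mono A.obj hh t).trans (orderHom_freeLift h'.hom t).ge)

variable (I) in
theorem isPosRightAdjoint : IsPosRightAdjoint (forget I) :=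
  ⟨Adjunction.leftAdjointOfEquiv freeHomEquiv fun _ _ _ _ _ => rfl,
    fun _ _ _ _ h => freeHomEquiv_symm_mono (comp_mono_left h _),
    ⟨Adjunction.adjunctionOfEquivLeft freeHomEquiv fun _ _ _ _ _ => rfl⟩⟩

/-! ### Filtered colimits in a variety -/

section Filtered

variable {J : Type u} [Category.{u} J] (D : J ⥤ Variety I)

theorem orderHom_map_comp {i j k : J} (f : i ⟶ j) (g : j ⟶ k) (x : (D.obj i).obj.carrier) :
    orderHom (D.map (f ≫ g)) x = orderHom (D.map g) (orderHom (D.map f) x) := by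
  rw [D.map_comp, orderHom_comp]

theorem orderHom_map_id {i : J} (x : (D.obj i).obj.carrier) : orderHom (D.map (𝟙 i)) x = x := by
  rw [D.map_id, orderHom_id]

/-- Elements of the diagram are related if at some later stage the first one lies below the
second one. This is the preorder which defines the filtered colimit. -/
def ColimRel (a b : Σ j, (D.obj j).obj.carrier) : Prop :=
  ∃ (l : J) (f : a.1 ⟶ l) (g : b.1 ⟶ l), orderHom (D.map f) a.2 ≤ orderHom (D.map g) b.2

theorem colimRel_refl (a : Σ j, (D.obj j).obj.carrier) : ColimRel D a a := ⟨a.1, 𝟙 _, 𝟙 _, le_rfl⟩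

theorem colimRel_map {j k : J} (f : j ⟶ k) (x : (D.obj j).obj.carrier) :
    ColimRel D ⟨j, x⟩ ⟨k, orderHom (D.map f) x⟩ :=
  ⟨k, f, 𝟙 _, (orderHom_map_id D _).ge⟩

theorem map_colimRel {j k : J} (f : j ⟶ k) (x : (D.obj j).obj.carrier) :
    ColimRel D ⟨k, orderHom (D.map f) x⟩ ⟨j, x⟩ :=
  ⟨k, 𝟙 _, f, (orderHom_map_id D _).le⟩

theorem le_of_colimRel {Y : Type*} [PartialOrder Y] (g : ∀ j, (D.obj j).obj.carrier →o Y)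
    (hg : ∀ {j k : J} (f : j ⟶ k) (x : (D.obj j).obj.carrier), g k (orderHom (D.map f) x) = g j x)
    {a b : Σ j, (D.obj j).obj.carrier} (h : ColimRel D a b) : g a.1 a.2 ≤ g b.1 b.2 := by
  obtain ⟨l, f, f', h⟩ := h
  rw [← hg f, ← hg f']
  exact (g l).monotone h

variable [IsFiltered J]

variable {D} in
theorem ColimRel.trans {a b c : Σ j, (D.obj j).obj.carrier} (hab : ColimRel D a b)
    (hbc : ColimRel D b c) : ColimRel D a c := by
  obtain ⟨l, f, g, h⟩ := hab
  obtain ⟨l', f', g', h'⟩ := hbc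
  obtain ⟨m, p, q, hpq⟩ := IsFiltered.span g f'
  refine ⟨m, f ≫ p, g' ≫ q, ?_⟩
  have h₁ := (orderHom (D.map p)).monotone h
  have h₂ := (orderHom (D.map q)).monotone h'
  rw [← orderHom_map_comp, ← orderHom_map_comp] at h₁ h₂
  exact h₁.trans ((congrArg (fun k => orderHom (D.map k) b.2) hpq).le.trans h₂)

/-- Finitely many elements of the diagram can be moved to a common stage. -/
theorem exists_common_stage {n : ℕ} (x : Fin n → Σ j, (D.obj j).obj.carrier) :
    ∃ (k : J) (y : Fin n → (D.obj k).obj.carrier),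
      ∀ i, ColimRel D (x i) ⟨k, y i⟩ ∧ ColimRel D ⟨k, y i⟩ (x i) := by
  classical
  obtain ⟨k, hk⟩ := IsFiltered.sup_objs_exists (Finset.univ.image fun i => (x i).1)
  have f (i) : (x i).1 ⟶ k :=
    (hk (Finset.mem_image_of_mem (fun i => (x i).1) (Finset.mem_univ i))).some
  exact ⟨k, fun i => orderHom (D.map (f i)) (x i).2, fun i =>
    ⟨colimRel_map D (f i) _, map_colimRel D (f i) _⟩⟩

/-- Finitely many inequalities in the colimit hold at a common later stage. -/
theorem exists_forall_map_le {n : ℕ} {k : J} (x y : Fin n → (D.obj k).obj.carrier)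
    (h : ∀ i, ColimRel D ⟨k, x i⟩ ⟨k, y i⟩) :
    ∃ (m : J) (f : k ⟶ m), ∀ i, orderHom (D.map f) (x i) ≤ orderHom (D.map f) (y i) := by
  classical
  choose l f g hfg using h
  have hk : k ∈ insert k (Finset.univ.image l) := Finset.mem_insert_self _ _
  have hl (i) : l i ∈ insert k (Finset.univ.image l) :=
    Finset.mem_insert_of_mem (Finset.mem_image_of_mem l (Finset.mem_univ i))
  obtain ⟨m, T, hT⟩ := IsFiltered.sup_exists (insert k (Finset.univ.image l))
    ((Finset.univ.image fun i => ⟨k, l i, hk, hl i, f i⟩) ∪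
      (Finset.univ.image fun i => ⟨k, l i, hk, hl i, g i⟩))
  refine ⟨m, T hk, fun i => ?_⟩
  have h₁ : f i ≫ T (hl i) = T hk := hT hk (hl i) (Finset.mem_union_left _
    (Finset.mem_image.2 ⟨i, Finset.mem_univ i, rfl⟩))
  have h₂ : g i ≫ T (hl i) = T hk := hT hk (hl i) (Finset.mem_union_right _
    (Finset.mem_image.2 ⟨i, Finset.mem_univ i, rfl⟩))
  have h := (orderHom (D.map (T (hl i)))).monotone (hfg i)
  rwa [← orderHom_map_comp, ← orderHom_map_comp, h₁, h₂] at h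

theorem colimRel_op {n : ℕ} (s : S n) {k k' : J} (x : Fin n → (D.obj k).obj.carrier)
    (y : Fin n → (D.obj k').obj.carrier) (h : ∀ i, ColimRel D ⟨k, x i⟩ ⟨k', y i⟩) :
    ColimRel D ⟨k, (D.obj k).obj.op s x⟩ ⟨k', (D.obj k').obj.op s y⟩ := by
  let a := IsFiltered.leftToMax k k'
  let b := IsFiltered.rightToMax k k'
  obtain ⟨m, f, hf⟩ := exists_forall_map_le D (fun i => orderHom (D.map a) (x i))
    (fun i => orderHom (D.map b) (y i)) fun i =>
      (map_colimRel D a _).trans ((h i).trans (colimRel_map D b _))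
  refine ⟨m, a ≫ f, b ≫ f, ?_⟩
  simp only [orderHom_op, orderHom_map_comp]
  exact (D.obj m).obj.op_mono s hf

/-- The elements of the diagram, with operations which are computed at a common stage of the
arguments. -/
noncomputable abbrev colimPreAlg : PreAlg S where
  carrier := Σ j, (D.obj j).obj.carrier
  rel := ColimRel D
  rel_refl := colimRel_refl D
  rel_trans := ColimRel.trans
  op s x := ⟨_, (D.obj _).obj.op s (exists_common_stage D x).choose_spec.choose⟩
  op_rel s x y h := colimRel_op D s _ _ fun i =>
    ((exists_common_stage D x).choose_spec.choose_spec i).2.trans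
      ((h i).trans ((exists_common_stage D y).choose_spec.choose_spec i).1)

theorem colimPreAlg_op {n : ℕ} (s : S n) (k : J) (x : Fin n → (D.obj k).obj.carrier) :
    (colimPreAlg D).proj ⟨k, (D.obj k).obj.op s x⟩ =
      (colimPreAlg D).quot.op s (fun i => (colimPreAlg D).proj ⟨k, x i⟩) := by
  rw [PreAlg.op_proj]
  have h := (exists_common_stage D fun i => ⟨k, x i⟩).choose_spec.choose_spec
  exact PreAlg.proj_eq_proj (colimRel_op D s _ _ fun i => (h i).1)
    (colimRel_op D s _ _ fun i => (h i).2)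

theorem satisfies_colimPreAlg : Satisfies I (colimPreAlg D).quot := fun p hp x => by
  choose z hz using fun i => PreAlg.proj_surjective (x i)
  obtain ⟨N₁, h₁⟩ := p.1.exists_eval_congr
  obtain ⟨N₂, h₂⟩ := p.2.exists_eval_congr
  -- one more variable than necessary ensures that the common stage is nonempty
  let N := max N₁ N₂ + 1
  obtain ⟨k, y, hy⟩ := exists_common_stage D fun i : Fin N => z i
  let y' : ℕ → (D.obj k).obj.carrier := fun i => if h : i < N then y ⟨i, h⟩ else y ⟨0, by omega⟩
  have hy' : ∀ i < N, x i = (colimPreAlg D).proj ⟨k, y' i⟩ := fun i hi => by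
    rw [← hz i]
    simp only [y', hi, dite_true]
    exact PreAlg.proj_eq_proj (hy ⟨i, hi⟩).1 (hy ⟨i, hi⟩).2
  have hN₁ : N₁ ≤ N := (le_max_left _ _).trans (Nat.le_succ _)
  have hN₂ : N₂ ≤ N := (le_max_right _ _).trans (Nat.le_succ _)
  have he (t : OrdTerm S) := OrdTerm.eval_map (A := (D.obj k).obj) (B := (colimPreAlg D).quot)
    (fun a => (colimPreAlg D).proj ⟨k, a⟩) (fun s x => colimPreAlg_op D s k x) y' t
  rw [h₁ _ x _ fun i hi => hy' i (hi.trans_le hN₁), h₂ _ x _ fun i hi => hy' i (hi.trans_le hN₂),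
    he, he]
  exact PreAlg.proj_le_proj.2 ⟨k, 𝟙 _, 𝟙 _,
    (orderHom (D.map (𝟙 k))).monotone ((D.obj k).property p hp y')⟩

/-- The filtered colimit cocone of a diagram in a variety. -/
noncomputable def colimCocone : Cocone D where
  pt := ⟨(colimPreAlg D).quot, satisfies_colimPreAlg D⟩
  ι :=
    { app := fun k => mkHom (B := ⟨(colimPreAlg D).quot, satisfies_colimPreAlg D⟩)
        ⟨fun a => (colimPreAlg D).proj ⟨k, a⟩, fun _ _ h => PreAlg.proj_le_proj.2
          ⟨k, 𝟙 _, 𝟙 _, (orderHom (D.map (𝟙 k))).monotone h⟩⟩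
        fun s x => colimPreAlg_op D s k x
      naturality := fun _ _ f => hom_ext fun a =>
        PreAlg.proj_eq_proj (P := colimPreAlg D) (map_colimRel D f a) (colimRel_map D f a) }

theorem nonempty_isColimit_colimCocone : Nonempty (IsColimit (colimCocone D)) := by
  have hle (s : Cocone D) {a b : Σ j, (D.obj j).obj.carrier} (h : ColimRel D a b) :
      orderHom (s.ι.app a.1) a.2 ≤ orderHom (s.ι.app b.1) b.2 :=
    le_of_colimRel D (fun j => orderHom (s.ι.app j))
      (fun f x => congrArg (fun k => orderHom k x) (s.w f)) h
  have hop (s : Cocone D) {n : ℕ} (s' : S n) (x : Fin n → (colimPreAlg D).carrier) :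
      orderHom (s.ι.app ((colimPreAlg D).op s' x).1) ((colimPreAlg D).op s' x).2 =
        s.pt.obj.op s' (fun i => orderHom (s.ι.app (x i).1) (x i).2) := by
    refine (orderHom_op (s.ι.app _) s' _).trans (congrArg _ (funext fun i => ?_))
    have h := (exists_common_stage D x).choose_spec.choose_spec i
    exact le_antisymm (hle s h.2) (hle s h.1)
  refine ⟨⟨fun s => liftHom (P := colimPreAlg D) (hP := satisfies_colimPreAlg D) _ (hle s) (hop s),
    fun s j => hom_ext fun a => liftHom_proj (P := colimPreAlg D) (hP := satisfies_colimPreAlg D) _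
      (hle s) (hop s) ⟨j, a⟩,
    fun s m hm => hom_ext fun a => ?_⟩⟩
  obtain ⟨⟨j, x⟩, rfl⟩ := PreAlg.proj_surjective a
  refine Eq.trans ?_ (liftHom_proj (P := colimPreAlg D) (hP := satisfies_colimPreAlg D) _
    (hle s) (hop s) ⟨j, x⟩).symm
  exact congrArg (fun k => orderHom k x) (hm j)

theorem isConicalColimit_forget_colimCocone :
    IsConicalColimit ((forget I).mapCocone (colimCocone D)) := by
  let g (s : Cocone (D ⋙ forget I)) (j : J) : (D.obj j).obj.carrier →o s.pt := (s.ι.app j).hom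
  have hle (s : Cocone (D ⋙ forget I)) {a b : Σ j, (D.obj j).obj.carrier} (h : ColimRel D a b) :
      g s a.1 a.2 ≤ g s b.1 b.2 :=
    le_of_colimRel D (g s) (fun {j _} f x =>
      congrArg (fun h : (forget I).obj (D.obj j) ⟶ s.pt => h x) (s.w f)) h
  refine ⟨⟨⟨fun s => PartOrd.ofHom (X := (colimPreAlg D).Quot)
    (PreAlg.liftOrderHom (fun a => g s a.1 a.2) (hle s)), fun s j => ?_,
    fun s m hm => ?_⟩⟩, fun f g h a => ?_⟩
  · ext a
    exact PreAlg.liftOrderHom_proj (P := colimPreAlg D) _ (hle s) ⟨j, a⟩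
  · ext a
    obtain ⟨⟨j, x⟩, rfl⟩ := PreAlg.proj_surjective a
    refine Eq.trans ?_ (PreAlg.liftOrderHom_proj (P := colimPreAlg D) _ (hle s) ⟨j, x⟩).symm
    exact congrArg (fun k : (forget I).obj (D.obj j) ⟶ s.pt => k x) (hm j)
  · obtain ⟨⟨j, x⟩, rfl⟩ := PreAlg.proj_surjective a
    exact h j x

end Filtered

variable (I) in
theorem isFinitary : IsFinitary (forget I) := fun J _ _ D c hc => by
  obtain ⟨h⟩ := hc.1
  obtain ⟨h'⟩ := nonempty_isColimit_colimCocone D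
  exact (isConicalColimit_forget_colimCocone D).of_iso
    ((Cocone.functoriality D (forget I)).mapIso (h'.uniqueUpToIso h))

end Variety

/-! ### Transport along enriched equivalences -/

section Transport

theorem IsReflexivePos.map {K : Type w} [Category.{v} K] {L : Type w'} [Category.{v'} L] (F : K ⥤ L)
    {V X : K} {u₀ u₁ : V ⟶ X} (h : IsReflexivePos u₀ u₁) :
    IsReflexivePos (F.map u₀) (F.map u₁) := by
  obtain ⟨d, h₀, h₁⟩ := h
  exact ⟨F.map d, by rw [← F.map_comp, h₀, F.map_id], by rw [← F.map_comp, h₁, F.map_id]⟩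

variable {K : Type w} [Category.{v} K] [PosEnriched K] {L : Type w'} [Category.{v'} L]
  [PosEnriched L] {E : K ⥤ L}

theorem IsPosEquivalence.exists_iso (hE : IsPosEquivalence E) (Y : L) :
    ∃ X : K, Nonempty (E.obj X ≅ Y) := by
  have := hE.1
  exact ⟨_, ⟨E.objObjPreimageIso Y⟩⟩

theorem IsPosEquivalence.exists_map (hE : IsPosEquivalence E) {X Y : K} (f : E.obj X ⟶ E.obj Y) :
    ∃ g : X ⟶ Y, E.map g = f := by
  have := hE.1
  exact E.map_surjective f

theorem IsPosEquivalence.map_injective (hE : IsPosEquivalence E) {X Y : K} {f g : X ⟶ Y}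
    (h : E.map f = E.map g) : f = g := by
  have := hE.1
  exact E.map_injective h

theorem IsCoinserter.map_equivalence (hE : IsPosEquivalence E) {V X Y : K} {u₀ u₁ : V ⟶ X}
    {f : X ⟶ Y} (hf : IsCoinserter u₀ u₁ f) :
    IsCoinserter (E.map u₀) (E.map u₁) (E.map f) where
  condition := by
    rw [← E.map_comp, ← E.map_comp, hE.2]
    exact hf.condition
  exists_desc {Z} f' h := by
    obtain ⟨Z', ⟨e⟩⟩ := hE.exists_iso Z
    obtain ⟨k, hk⟩ := hE.exists_map (f' ≫ e.inv)
    obtain ⟨g, rfl⟩ := hf.exists_desc k <| by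
      rw [← hE.2, E.map_comp, E.map_comp, hk]
      simpa using comp_mono_left h e.inv
    exact ⟨E.map g ≫ e.hom, by rw [← Category.assoc, ← E.map_comp, hk]; simp⟩
  le_of_comp_le {Z} g g' h := by
    obtain ⟨Z', ⟨e⟩⟩ := hE.exists_iso Z
    obtain ⟨k, hk⟩ := hE.exists_map (g ≫ e.inv)
    obtain ⟨k', hk'⟩ := hE.exists_map (g' ≫ e.inv)
    refine le_of_comp_iso_le e.symm ?_
    change g ≫ e.inv ≤ g' ≫ e.inv
    rw [← hk, ← hk', hE.2]
    refine hf.le_of_comp_le _ _ ?_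
    rw [← hE.2, E.map_comp, E.map_comp, hk, hk']
    simpa using comp_mono_left h e.inv

theorem IsCoinserter.of_map_equivalence (hE : IsPosEquivalence E) {V X Y : K} {u₀ u₁ : V ⟶ X}
    {f : X ⟶ Y} (hf : IsCoinserter (E.map u₀) (E.map u₁) (E.map f)) : IsCoinserter u₀ u₁ f where
  condition := by
    rw [← hE.2, E.map_comp, E.map_comp]
    exact hf.condition
  exists_desc f' h := by
    obtain ⟨g, hg⟩ := hf.exists_desc (E.map f') (by rwa [← E.map_comp, ← E.map_comp, hE.2])
    obtain ⟨k, rfl⟩ := hE.exists_map g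
    exact ⟨k, hE.map_injective (by rw [E.map_comp, hg])⟩
  le_of_comp_le g g' h := by
    rw [← hE.2]
    refine hf.le_of_comp_le _ _ ?_
    rwa [← E.map_comp, ← E.map_comp, hE.2]

theorem IsSubkernelPair.of_map_equivalence (hE : IsPosEquivalence E) {V X Y : K} {u₀ u₁ : V ⟶ X}
    {f : X ⟶ Y} (hf : IsSubkernelPair (E.map f) (E.map u₀) (E.map u₁)) :
    IsSubkernelPair f u₀ u₁ where
  condition := by
    rw [← hE.2, E.map_comp, E.map_comp]
    exact hf.condition
  exists_lift v₀ v₁ h := by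
    obtain ⟨g, h₀, h₁⟩ := hf.exists_lift (E.map v₀) (E.map v₁)
      (by rwa [← E.map_comp, ← E.map_comp, hE.2])
    obtain ⟨k, rfl⟩ := hE.exists_map g
    exact ⟨k, hE.map_injective (by rw [E.map_comp, h₀]), hE.map_injective (by rw [E.map_comp, h₁])⟩
  le_of_comp_le g g' h₀ h₁ := by
    rw [← hE.2]
    refine hf.le_of_comp_le _ _ ?_ ?_ <;> rwa [← E.map_comp, ← E.map_comp, hE.2]

theorem IsSubregularEpi.of_map_equivalence (hE : IsPosEquivalence E) {X Y : K} {f : X ⟶ Y}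
    (hf : IsSubregularEpi (E.map f)) : IsSubregularEpi f := by
  obtain ⟨V, u₀, u₁, h⟩ := hf
  obtain ⟨V', ⟨e⟩⟩ := hE.exists_iso V
  obtain ⟨k₀, hk₀⟩ := hE.exists_map (e.hom ≫ u₀)
  obtain ⟨k₁, hk₁⟩ := hE.exists_map (e.hom ≫ u₁)
  have := h.iso_comp e
  rw [← hk₀, ← hk₁] at this
  exact ⟨V', k₀, k₁, this.of_map_equivalence hE⟩

theorem HasSubkernelPairs.of_equivalence (hE : IsPosEquivalence E) (h : HasSubkernelPairs L) :
    HasSubkernelPairs K := fun X Y f => by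
  obtain ⟨V, u₀, u₁, h⟩ := h (E.map f)
  obtain ⟨V', ⟨e⟩⟩ := hE.exists_iso V
  obtain ⟨k₀, hk₀⟩ := hE.exists_map (e.hom ≫ u₀)
  obtain ⟨k₁, hk₁⟩ := hE.exists_map (e.hom ≫ u₁)
  have := h.iso_comp e
  rw [← hk₀, ← hk₁] at this
  exact ⟨V', k₀, k₁, this.of_map_equivalence hE⟩

theorem HasReflexiveCoinserters.of_equivalence (hE : IsPosEquivalence E)
    (h : HasReflexiveCoinserters L) : HasReflexiveCoinserters K := fun V X u₀ u₁ hu => by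
  obtain ⟨Y, f, hf⟩ := h _ _ (hu.map E)
  obtain ⟨Y', ⟨e⟩⟩ := hE.exists_iso Y
  obtain ⟨k, hk⟩ := hE.exists_map (f ≫ e.inv)
  have := hf.comp_iso e.symm
  rw [Iso.symm_hom, ← hk] at this
  exact ⟨Y', k, this.of_map_equivalence hE⟩

theorem IsConicalColimit.map_equivalence (hE : IsPosEquivalence E) {J : Type*} [Category* J]
    {D : J ⥤ K} {c : Cocone D} (hc : IsConicalColimit c) : IsConicalColimit (E.mapCocone c) := by
  have := hE.1
  refine ⟨hc.1.map fun h => isColimitOfPreserves E h, fun {Z} g g' h => ?_⟩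
  obtain ⟨Z', ⟨e⟩⟩ := hE.exists_iso Z
  obtain ⟨k, hk⟩ := hE.exists_map (X := c.pt) (g ≫ e.inv)
  obtain ⟨k', hk'⟩ := hE.exists_map (X := c.pt) (g' ≫ e.inv)
  refine le_of_comp_iso_le e.symm ?_
  change g ≫ e.inv ≤ g' ≫ e.inv
  rw [← hk, ← hk', hE.2]
  refine hc.2 _ _ fun j => ?_
  rw [← hE.2, E.map_comp, E.map_comp, hk, hk', ← Category.assoc, ← Category.assoc]
  exact comp_mono_left (h j) e.inv

theorem IsPosRightAdjoint.comp_equivalence (hE : IsPosEquivalence E) {M : Type*} [Category* M]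
    [PosEnriched M] {U : L ⥤ M} (hU : IsPosRightAdjoint U) : IsPosRightAdjoint (E ⋙ U) := by
  obtain ⟨F, hF, ⟨adj⟩⟩ := hU
  have := hE.1
  refine ⟨F ⋙ E.inv, fun X Y f g h => ?_, ⟨adj.comp E.asEquivalence.symm.toAdjunction⟩⟩
  have e (k : X ⟶ Y) : E.map (E.inv.map (F.map k)) =
      E.asEquivalence.counit.app _ ≫ F.map k ≫ E.asEquivalence.counitInv.app _ :=
    E.asEquivalence.fun_inv_map _ _ _
  rw [← hE.2]
  exact (e f).le.trans ((comp_mono_right _ (comp_mono_left (hF h) _)).trans (e g).ge)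

end Transport

theorem properties_of_isEquivalentToVariety {K : Type w} [Category.{v} K] [PosEnriched K]
    {U : K ⥤ PartOrd.{u}} (h : IsEquivalentToVariety U) :
    (HasSubkernelPairs K ∧ HasReflexiveCoinserters K) ∧
      (IsFinitary U ∧ IsPosRightAdjoint U ∧ ReflectsSubregularEpis U ∧
        PreservesReflexiveCoinserters U) := by
  obtain ⟨S, I, E, hE, rfl⟩ := h
  refine ⟨⟨(Variety.hasSubkernelPairs I).of_equivalence hE,
    (Variety.hasReflexiveCoinserters I).of_equivalence hE⟩, ?_,
    (Variety.isPosRightAdjoint I).comp_equivalence hE, ?_, ?_⟩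
  · exact fun J _ _ D c hc => Variety.isFinitary I J (D ⋙ E) _ (hc.map_equivalence hE)
  · exact fun _ _ f hf => (Variety.reflectsSubregularEpis I (E.map f) hf).of_map_equivalence hE
  · exact fun _ _ _ u₀ u₁ f hu hf => Variety.preservesReflexiveCoinserters I _ _ _ (hu.map E)
      (hf.map_equivalence hE)

/-! ### Discrete posets -/

/-- The discrete poset on a type. -/
def disc (α : Type u) : PartOrd.{u} :=
  @PartOrd.of α
    { le := Eq
      le_refl := Eq.refl
      le_trans := fun _ _ _ => Eq.trans
      le_antisymm := fun _ _ h _ => h }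

/-- A map from a type to a poset, as a monotone map on the discrete poset. -/
def discHom {α : Type u} {X : PartOrd.{u}} (f : α → X) : disc α ⟶ X :=
  PartOrd.ofHom (X := disc α) ⟨f, fun _ _ h => (congrArg f h).le⟩

/-- A map of types, as a monotone map of discrete posets. -/
def discMap {α β : Type u} (f : α → β) : disc α ⟶ disc β := discHom (X := disc β) f

/-- An `n`-tuple in a poset, as a monotone map on a discrete poset. -/
def tuple {n : ℕ} {X : PartOrd.{u}} (x : Fin n → X) : disc (ULift.{u} (Fin n)) ⟶ X :=
  discHom fun i => x i.down

theorem discMap_comp_tuple {n m : ℕ} {X : PartOrd.{u}} (z : Fin n → Fin m) (x : Fin m → X) :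
    discMap (fun i : ULift.{u} (Fin n) => ULift.up (z i.down)) ≫ tuple x =
      tuple fun i => x (z i) := rfl

theorem tuple_comp {n : ℕ} {X Y : PartOrd.{u}} (x : Fin n → X) (g : X ⟶ Y) :
    tuple x ≫ g = tuple fun i => g (x i) := rfl

/-- The discrete poset of the pairs `(x, y)` with `x ≤ y`. -/
abbrev discLE (X : PartOrd.{u}) : PartOrd.{u} := disc {p : X × X // p.1 ≤ p.2}

/-- The lesser component of a pair. -/
abbrev discLEFst (X : PartOrd.{u}) : discLE X ⟶ disc X := discMap fun p => p.1.1

/-- The greater component of a pair. -/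
abbrev discLESnd (X : PartOrd.{u}) : discLE X ⟶ disc X := discMap fun p => p.1.2

/-- The identity, from the discrete poset to the given one. -/
abbrev discCounit (X : PartOrd.{u}) : disc X ⟶ X := discHom fun x => x

theorem isReflexivePos_discLE (X : PartOrd.{u}) : IsReflexivePos (discLEFst X) (discLESnd X) :=
  ⟨discMap fun x => ⟨(x, x), le_rfl⟩, rfl, rfl⟩

/-- Every poset is a reflexive coinserter of discrete posets. -/
theorem isCoinserter_discCounit (X : PartOrd.{u}) :
    IsCoinserter (discLEFst X) (discLESnd X) (discCounit X) :=
  isCoinserter_of_surjective (fun x => ⟨x, rfl⟩) (fun p => p.2)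
    fun _ hf' x x' h => hf' ⟨(x, x'), h⟩

/-- The diagram of the finite subsets of a type, as discrete posets. -/
def finsetDiagram (α : Type u) : Finset α ⥤ PartOrd.{u} where
  obj T := disc T
  map {_ T'} i := discMap fun a => ⟨a.1, leOfHom i a.2⟩

/-- A discrete poset as a cocone on its finite subsets. -/
def finsetCocone (α : Type u) : Cocone (finsetDiagram α) where
  pt := disc α
  ι := { app := fun _ => discMap fun a => a.1 }

theorem isConicalColimit_finsetCocone (α : Type u) : IsConicalColimit (finsetCocone α) := by
  refine ⟨⟨⟨fun s => discHom fun a => s.ι.app {a} ⟨a, Finset.mem_singleton_self a⟩, fun s T => ?_,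
    fun s m hm => ?_⟩⟩, fun f g h a => h {a} ⟨a, Finset.mem_singleton_self a⟩⟩
  · ext a
    have i : ({a.1} : Finset α) ⟶ T := homOfLE (Finset.singleton_subset_iff.2 a.2)
    exact (congrArg (fun k : disc ({a.1} : Finset α) ⟶ s.pt =>
      k ⟨a.1, Finset.mem_singleton_self a.1⟩) (s.w i)).symm
  · ext a
    exact congrArg (fun k : disc ({a} : Finset α) ⟶ s.pt =>
      k ⟨a, Finset.mem_singleton_self a⟩) (hm {a})

/-! ### The algebras of a concrete category with free objects -/

section Backward

variable {K : Type w} [Category.{u} K] {U : K ⥤ PartOrd.{u}} {F : PartOrd.{u} ⥤ K} (adj : F ⊣ U)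

/-- The underlying map of the extension of a monotone map `x` to the free object. -/
def extend {X : PartOrd.{u}} {A : K} (x : X ⟶ U.obj A) : U.obj (F.obj X) ⟶ U.obj A :=
  U.map ((adj.homEquiv X A).symm x)

theorem extend_comp {X : PartOrd.{u}} {A B : K} (x : X ⟶ U.obj A) (g : A ⟶ B) :
    extend adj x ≫ U.map g = extend adj (x ≫ U.map g) := by
  rw [extend, extend, adj.homEquiv_naturality_right_symm, U.map_comp]

theorem map_extend_apply {X : PartOrd.{u}} {A B : K} (x : X ⟶ U.obj A) (g : A ⟶ B)
    (t : U.obj (F.obj X)) : U.map g (extend adj x t) = extend adj (x ≫ U.map g) t :=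
  congrArg (fun k : U.obj (F.obj X) ⟶ U.obj B => k t) (extend_comp adj x g)

theorem extend_map_apply {X Y : PartOrd.{u}} {A : K} (p : Y ⟶ X) (x : X ⟶ U.obj A)
    (t : U.obj (F.obj Y)) : extend adj x (U.map (F.map p) t) = extend adj (p ≫ x) t := by
  have h : U.map (F.map p) ≫ extend adj x = extend adj (p ≫ x) := by
    rw [extend, extend, adj.homEquiv_naturality_left_symm, U.map_comp]
  exact congrArg (fun k : U.obj (F.obj Y) ⟶ U.obj A => k t) h

theorem map_map_apply {X Y Z : PartOrd.{u}} (p : X ⟶ Y) (q : Y ⟶ Z) (t : U.obj (F.obj X)) :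
    U.map (F.map q) (U.map (F.map p) t) = U.map (F.map (p ≫ q)) t := by
  rw [F.map_comp, U.map_comp]
  rfl

theorem extend_unit_apply {X : PartOrd.{u}} {A : K} (x : X ⟶ U.obj A) (a : X) :
    extend adj x (adj.unit.app X a) = x a := by
  have h : adj.unit.app X ≫ extend adj x = x :=
    (adj.homEquiv_unit _ _ _).symm.trans (Equiv.apply_symm_apply _ _)
  exact congrArg (fun k : X ⟶ U.obj A => k a) h

theorem map_counit_apply {A : K} (t : U.obj (F.obj (U.obj A))) :
    U.map (adj.counit.app A) t = extend adj (𝟙 _) t := by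
  have h : (adj.homEquiv (U.obj A) A).symm (𝟙 _) = adj.counit.app A := by
    rw [adj.homEquiv_counit]
    simp
  rw [extend, h]

theorem extend_mono [PosEnriched K] (hF : IsPosFunctor F) (hU : IsPosFunctor U) {X : PartOrd.{u}}
    {A : K} {x y : X ⟶ U.obj A} (h : x ≤ y) (t : U.obj (F.obj X)) :
    extend adj x t ≤ extend adj y t := by
  refine hU ((homEquiv_le_iff adj hF hU).1 ?_) t
  rwa [Equiv.apply_symm_apply, Equiv.apply_symm_apply]

variable (U F) in
/-- The signature of a concrete category with free objects: the `n`-ary symbols are the elements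
of the free object on `n` generators. -/
abbrev Sig (n : ℕ) : Type u := U.obj (F.obj (disc (ULift.{u} (Fin n))))

theorem map_discMap_apply {α β γ : Type u} (f : α → β) (g : β → γ) (t : U.obj (F.obj (disc α))) :
    U.map (F.map (discMap g)) (U.map (F.map (discMap f)) t) =
      U.map (F.map (discMap fun a => g (f a))) t :=
  map_map_apply _ _ t

variable [PosEnriched K] (hF : IsPosFunctor F) (hU : IsPosFunctor U)

/-- The algebra structure on the underlying poset of an object `A`: the value of `t` at the tuple
`x` is the image of `t` under the extension of `x` to the free object. -/
abbrev alg (A : K) : OrdAlg (Sig U F) where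
  carrier := U.obj A
  op t x := extend adj (tuple x) t
  op_mono {n} t x y h := extend_mono adj hF hU (x := tuple x) (y := tuple y)
    (fun i : ULift (Fin n) => h i.down) t

/-- The inequations which hold in the algebras of all objects. -/
def inequations : Set (OrdTerm (Sig U F) × OrdTerm (Sig U F)) :=
  {p | ∀ (A : K) (x : ℕ → U.obj A), p.1.eval (alg adj hF hU A) x ≤ p.2.eval (alg adj hF hU A) x}

/-- The algebra of an object, in the variety of all algebras in which these inequations hold. -/
abbrev comparisonObj (A : K) : Variety (inequations adj hF hU) :=
  ⟨alg adj hF hU A, fun p (hp : p ∈ inequations adj hF hU) => hp A⟩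

/-- The comparison functor, to the variety of all algebras in which these inequations hold. -/
def comparison : K ⥤ Variety (inequations adj hF hU) where
  obj A := comparisonObj adj hF hU A
  map {A B} f := Variety.mkHom (A := comparisonObj adj hF hU A) (B := comparisonObj adj hF hU B)
    (U.map f).hom fun t x => map_extend_apply adj (tuple x) f t
  map_id A := Variety.hom_ext fun a => congrArg (fun k : U.obj A ⟶ U.obj A => k a) (U.map_id A)
  map_comp {A _ C} f g := Variety.hom_ext fun a =>
    congrArg (fun k : U.obj A ⟶ U.obj C => k a) (U.map_comp f g)

theorem comparison_comp_forget : U = comparison adj hF hU ⋙ Variety.forget _ := rfl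

end Backward

section Comparison

variable {K : Type w} [Category.{u} K] [PosEnriched K] {U : K ⥤ PartOrd.{u}}
  {F : PartOrd.{u} ⥤ K}

/-! ### Generation of free objects by tuples -/

section Generation

theorem isCoinserter_map_discCounit (adj : F ⊣ U) (hF : IsPosFunctor F) (hU : IsPosFunctor U)
    (hpres : PreservesReflexiveCoinserters U) (X : PartOrd.{u}) :
    IsCoinserter (U.map (F.map (discLEFst X))) (U.map (F.map (discLESnd X)))
      (U.map (F.map (discCounit X))) :=
  hpres _ _ _ ((isReflexivePos_discLE X).map F)
    ((isCoinserter_discCounit X).map_leftAdjoint adj hF hU)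

theorem isConicalColimit_map_finsetCocone (adj : F ⊣ U) (hF : IsPosFunctor F) (hU : IsPosFunctor U)
    (hfin : IsFinitary U) (α : Type u) :
    IsConicalColimit (U.mapCocone (F.mapCocone (finsetCocone α))) := by
  classical
  exact hfin (Finset α) _ _ ((isConicalColimit_finsetCocone α).map_leftAdjoint adj hF hU)

/-- Every element of a free object is the value of an operation at a tuple of generators. -/
theorem exists_map_tuple_eq (adj : F ⊣ U) (hF : IsPosFunctor F) (hU : IsPosFunctor U)
    (hfin : IsFinitary U) (hpres : PreservesReflexiveCoinserters U) {X : PartOrd.{u}}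
    (a : U.obj (F.obj X)) :
    ∃ (n : ℕ) (x : Fin n → X) (t : Sig U F n), U.map (F.map (tuple x)) t = a := by
  obtain ⟨b, rfl⟩ := (isCoinserter_map_discCounit adj hF hU hpres X).surjective a
  obtain ⟨T, t, rfl⟩ :=
    (isConicalColimit_map_finsetCocone adj hF hU hfin X).exists_apply_eq b
  refine ⟨T.card, fun i => (T.equivFin.symm i).1,
    U.map (F.map (discMap fun a : T => ULift.up (T.equivFin a))) t, ?_⟩
  refine (map_map_apply _ _ t).trans (Eq.trans ?_ (map_map_apply _ (discCounit X) t).symm)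
  refine congrArg (fun p : disc T ⟶ X => U.map (F.map p) t) (PartOrd.ext fun i => ?_)
  exact congrArg Subtype.val (T.equivFin.symm_apply_apply i)

end Generation

/-! ### The comparison functor is fully faithful -/

section FullyFaithful

theorem isSubregularEpi_counit (adj : F ⊣ U) (hrefl : ReflectsSubregularEpis U) (A : K) :
    IsSubregularEpi (adj.counit.app A) :=
  hrefl _ (isSubregularEpi_of_section _ (adj.unit.app (U.obj A))
    (adj.right_triangle_components A))

/-- `U` reflects the order of morphisms, because the counit is an order-epimorphism. -/
theorem map_le_map_iff (adj : F ⊣ U) (hF : IsPosFunctor F) (hU : IsPosFunctor U)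
    (hrefl : ReflectsSubregularEpis U) {A B : K} {f g : A ⟶ B} :
    U.map f ≤ U.map g ↔ f ≤ g := by
  refine ⟨fun h => ?_, fun h => hU h⟩
  obtain ⟨_, _, _, hc⟩ := isSubregularEpi_counit adj hrefl A
  refine hc.le_of_comp_le _ _ ((homEquiv_le_iff adj hF hU).1 ?_)
  have e (k : A ⟶ B) : adj.homEquiv (U.obj A) B (adj.counit.app A ≫ k) = U.map k := by
    rw [← Equiv.eq_symm_apply, adj.homEquiv_counit]
    simp
  exact (e f).le.trans (h.trans (e g).ge)

/-- Homomorphisms between the algebras of objects come from morphisms. A homomorphism `h` satisfies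
`U ε ≫ h = U k` for the morphism `k` on the free object which extends it, hence `k` factors through
the counit `ε`, as `ε` is the coinserter of its subkernel pair. -/
theorem exists_comparison_map_eq (adj : F ⊣ U) (hF : IsPosFunctor F) (hU : IsPosFunctor U)
    (hfin : IsFinitary U) (hpres : PreservesReflexiveCoinserters U)
    (hrefl : ReflectsSubregularEpis U) (hK : HasSubkernelPairs K) {A B : K}
    (h : comparisonObj adj hF hU A ⟶ comparisonObj adj hF hU B) :
    ∃ g : A ⟶ B, (comparison adj hF hU).map g = h := by
  let h' : U.obj A ⟶ U.obj B := PartOrd.ofHom (X := U.obj A) (Y := U.obj B) (Variety.orderHom h)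
  have key (a : U.obj (F.obj (U.obj A))) : extend adj h' a = h' (U.map (adj.counit.app A) a) := by
    obtain ⟨n, x, t, rfl⟩ := exists_map_tuple_eq adj hF hU hfin hpres a
    rw [extend_map_apply, map_counit_apply, extend_map_apply]
    exact (Variety.orderHom_op h t x).symm
  obtain ⟨V, u₀, u₁, hu⟩ := hK (adj.counit.app A)
  have hc := (isSubregularEpi_counit adj hrefl A).isCoinserter hu
  obtain ⟨g, hg⟩ := hc.exists_desc ((adj.homEquiv _ _).symm h') <| by
    rw [← map_le_map_iff adj hF hU hrefl, U.map_comp, U.map_comp]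
    intro v
    change extend adj h' (U.map u₀ v) ≤ extend adj h' (U.map u₁ v)
    rw [key, key]
    refine h'.hom.monotone ?_
    have := hU hc.condition
    rw [U.map_comp, U.map_comp] at this
    exact this v
  refine ⟨g, Variety.hom_ext fun a => ?_⟩
  have ha : U.map (adj.counit.app A) (adj.unit.app (U.obj A) a) = a :=
    congrArg (fun k : U.obj A ⟶ U.obj A => k a) (adj.right_triangle_components A)
  change U.map g a = h' a
  rw [← ha, ← key, extend, ← hg, U.map_comp]
  rfl

end FullyFaithful

/-! ### The free objects carry the free algebras of the variety -/

section Extension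

variable {adj : F ⊣ U} {hF : IsPosFunctor F} {hU : IsPosFunctor U}

/-- Validity of an inequation between terms in the variables `x₀, …, xₘ₋₁`, without an assignment of
the other variables. The element `a` is needed for the case `m = 0`. -/
theorem eval_le_eval (A : Variety (inequations adj hF hU)) {m : ℕ} (y : Fin m → A.obj.carrier)
    (a : A.obj.carrier) {p q : OrdTerm (Sig U F)} (hpq : (p, q) ∈ inequations adj hF hU) :
    ∃ y' : ℕ → A.obj.carrier, (∀ i : Fin m, y' i = y i) ∧ p.eval A.obj y' ≤ q.eval A.obj y' :=
  ⟨fun i => if h : i < m then y ⟨i, h⟩ else a, fun i => by simp, A.property _ hpq _⟩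

/-- Inequalities between elements of the free objects on finite sets of generators are valid as
inequations in every algebra of the variety. -/
theorem op_comp_le_op_comp (A : Variety (inequations adj hF hU)) {n m k : ℕ} {t : Sig U F n}
    {s : Sig U F m} {z : Fin n → Fin k} {z' : Fin m → Fin k}
    (h : U.map (F.map (discMap fun i : ULift.{u} (Fin n) => ULift.up.{u} (z i.down))) t ≤
      U.map (F.map (discMap fun i : ULift.{u} (Fin m) => ULift.up.{u} (z' i.down))) s)
    (y : Fin k → A.obj.carrier) :
    A.obj.op t (fun i => y (z i)) ≤ A.obj.op s (fun i => y (z' i)) := by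
  obtain ⟨y', hy', H⟩ := eval_le_eval A y (A.obj.op t fun i => y (z i))
    (p := .app t fun i => .var (z i)) (q := .app s fun i => .var (z' i)) fun B x => by
      have := (extend adj (tuple (X := U.obj B) fun i : Fin k => x i)).hom.monotone h
      rwa [extend_map_apply, extend_map_apply, discMap_comp_tuple, discMap_comp_tuple] at this
  simpa only [OrdTerm.eval, hy'] using H

/-- The operations of an algebra, with arguments indexed by any finite type. -/
noncomputable def finOp (A : Variety (inequations adj hF hU)) {α : Type u} [Finite α]
    (t : U.obj (F.obj (disc α))) (x : α → A.obj.carrier) : A.obj.carrier :=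
  A.obj.op
    (U.map (F.map (discMap fun a => ULift.up (Finite.equivFin α a))) t : Sig U F (Nat.card α))
    fun i => x ((Finite.equivFin α).symm i)

theorem finOp_comp_le_finOp_comp (A : Variety (inequations adj hF hU)) {α β γ : Type u} [Finite α]
    [Finite β] [Finite γ] {t : U.obj (F.obj (disc α))} {s : U.obj (F.obj (disc β))} (z : α → γ)
    (z' : β → γ) (h : U.map (F.map (discMap z)) t ≤ U.map (F.map (discMap z')) s)
    (y : γ → A.obj.carrier) :
    finOp A t (fun a => y (z a)) ≤ finOp A s (fun b => y (z' b)) := by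
  let e := Finite.equivFin γ
  have H := op_comp_le_op_comp A (k := Nat.card γ)
    (t := U.map (F.map (discMap fun a => ULift.up.{u} (Finite.equivFin α a))) t)
    (s := U.map (F.map (discMap fun a => ULift.up.{u} (Finite.equivFin β a))) s)
    (z := fun i => e (z ((Finite.equivFin α).symm i)))
    (z' := fun i => e (z' ((Finite.equivFin β).symm i))) ?_ (fun i => y (e.symm i))
  · simp only [Equiv.symm_apply_apply] at H
    exact H
  · have h' := (U.map (F.map (discMap fun c => ULift.up.{u} (e c)))).hom.monotone h
    rw [map_discMap_apply, map_discMap_apply] at h' ⊢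
    simpa only [Equiv.symm_apply_apply] using h'

theorem finOp_comp_eq_finOp (A : Variety (inequations adj hF hU)) {α γ : Type u} [Finite α]
    [Finite γ] (t : U.obj (F.obj (disc α))) (z : α → γ) (y : γ → A.obj.carrier) :
    finOp A t (fun a => y (z a)) = finOp A (U.map (F.map (discMap z)) t) y := by
  have h : U.map (F.map (discMap fun c : γ => c)) (U.map (F.map (discMap z)) t) =
      U.map (F.map (discMap z)) t := map_discMap_apply _ _ _
  exact le_antisymm (finOp_comp_le_finOp_comp A z (fun c => c) h.ge y)
    (finOp_comp_le_finOp_comp A (fun c => c) z h.le y)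

theorem finOp_fin (A : Variety (inequations adj hF hU)) {n : ℕ} (t : Sig U F n)
    (x : Fin n → A.obj.carrier) : finOp A t (fun i => x i.down) = A.obj.op t x := by
  let e := Finite.equivFin (ULift.{u} (Fin n))
  have h : U.map (F.map (discMap fun i : ULift.{u} (Fin _) => ULift.up.{u} (e.symm i.down).down))
      (U.map (F.map (discMap fun a => ULift.up.{u} (e a))) t) =
      U.map (F.map (discMap fun i : ULift.{u} (Fin n) => ULift.up.{u} i.down)) t := by
    rw [map_discMap_apply]
    simp only [Equiv.symm_apply_apply]
  exact le_antisymm (op_comp_le_op_comp A (z' := fun i => i) h.le x)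
    (op_comp_le_op_comp A (z := fun i => i) h.ge x)

/-- Maps from a set into an algebra of the variety extend to the free object on the set, which is
the filtered colimit of the free objects on the finite subsets. -/
theorem exists_extension_disc (hfin : IsFinitary U) (A : Variety (inequations adj hF hU))
    {α : Type u} (h : α → A.obj.carrier) :
    ∃ k : U.obj (F.obj (disc α)) ⟶ (Variety.forget _).obj A,
      ∀ (n : ℕ) (x : Fin n → α) (t : Sig U F n),
        k (U.map (F.map (discMap fun i : ULift.{u} (Fin n) => x i.down)) t) =
          A.obj.op t (fun i => h (x i)) := by
  classical
  have hc := isConicalColimit_map_finsetCocone adj hF hU hfin α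
  obtain ⟨hl⟩ := hc.1
  let g (T : Finset α) : U.obj (F.obj (disc T)) ⟶ (Variety.forget _).obj A :=
    PartOrd.ofHom (X := U.obj (F.obj (disc T))) (Y := A.obj.carrier)
      ⟨fun t => finOp A t fun a => h a.1, fun t s hts =>
        finOp_comp_le_finOp_comp A (fun a => a) (fun a => a)
          ((U.map (F.map (discMap fun a => a))).hom.monotone hts) fun a => h a.1⟩
  let c : Cocone ((finsetDiagram α ⋙ F) ⋙ U) := ⟨(Variety.forget _).obj A, ⟨g, fun T T' i => by
    ext t
    exact (finOp_comp_eq_finOp A t (fun a : T => (⟨a.1, leOfHom i a.2⟩ : T'))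
      fun a => h a.1).symm⟩⟩
  refine ⟨hl.desc c, fun n x t => ?_⟩
  let T : Finset α := Finset.univ.image x
  let x' (i : ULift.{u} (Fin n)) : T :=
    ⟨x i.down, Finset.mem_image_of_mem x (Finset.mem_univ i.down)⟩
  have hx : U.map (F.map (discMap fun i : ULift.{u} (Fin n) => x i.down)) t =
      U.map (F.map (discMap fun a : T => a.1))
        (U.map (F.map (discMap x')) t) := (map_discMap_apply x' (fun a : T => a.1) t).symm
  rw [hx]
  refine (congrArg (fun k : U.obj (F.obj (disc T)) ⟶ c.pt =>
    k (U.map (F.map (discMap x')) t)) (hl.fac c T)).trans ?_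
  exact (finOp_comp_eq_finOp A t x' fun a => h a.1).symm.trans (finOp_fin A t fun i => h (x i))

/-- Monotone maps from a poset into an algebra of the variety extend to the free object on the
poset, which is a coinserter of free objects on sets. -/
theorem exists_extension (hfin : IsFinitary U) (hpres : PreservesReflexiveCoinserters U)
    (A : Variety (inequations adj hF hU)) {X : PartOrd.{u}} (h : X →o A.obj.carrier) :
    ∃ k : U.obj (F.obj X) ⟶ (Variety.forget _).obj A,
      ∀ (n : ℕ) (x : Fin n → X) (t : Sig U F n),
        k (U.map (F.map (tuple x)) t) = A.obj.op t (fun i => h (x i)) := by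
  obtain ⟨k, hk⟩ := exists_extension_disc hfin A (α := X) h
  obtain ⟨g, hg⟩ := (isCoinserter_map_discCounit adj hF hU hpres X).exists_desc k fun v => by
    obtain ⟨n, x, t, rfl⟩ := exists_map_tuple_eq adj hF hU hfin hpres v
    have h₀ : k (U.map (F.map (discLEFst X)) (U.map (F.map (tuple x)) t)) = _ :=
      (congrArg k (map_map_apply (tuple x) (discLEFst X) t)).trans (hk n (fun i => (x i).1.1) t)
    have h₁ : k (U.map (F.map (discLESnd X)) (U.map (F.map (tuple x)) t)) = _ :=
      (congrArg k (map_map_apply (tuple x) (discLESnd X) t)).trans (hk n (fun i => (x i).1.2) t)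
    refine h₀.le.trans (le_trans ?_ h₁.ge)
    exact A.obj.op_mono t fun i => h.monotone (x i).2
  refine ⟨g, fun n x t => ?_⟩
  rw [← hk n x t, ← hg]
  refine congrArg g ?_
  exact (map_map_apply (discMap fun i : ULift.{u} (Fin n) => x i.down) (discCounit X) t).symm

/-- The extension to a free object preserves the operations. -/
theorem extension_op (hfin : IsFinitary U) (hpres : PreservesReflexiveCoinserters U)
    {A : Variety (inequations adj hF hU)} {X : PartOrd.{u}} {h : X → A.obj.carrier}
    {k : U.obj (F.obj X) ⟶ (Variety.forget _).obj A}
    (hk : ∀ (n : ℕ) (x : Fin n → X) (t : Sig U F n),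
      k (U.map (F.map (tuple x)) t) = A.obj.op t (fun i => h (x i)))
    {n : ℕ} (t : Sig U F n) (a : Fin n → U.obj (F.obj X)) :
    k (extend adj (tuple a) t) = A.obj.op t (fun i => k (a i)) := by
  choose m x s hs using fun i => exists_map_tuple_eq adj hF hU hfin hpres (a i)
  -- all elements of the tuple `a` are values of operations at one common tuple `w`
  let e := Finite.equivFin (Σ i, Fin (m i))
  let N := Nat.card (Σ i, Fin (m i))
  let w (j : Fin N) : X := x (e.symm j).1 (e.symm j).2
  let s' (i : Fin n) : Sig U F N :=
    U.map (F.map (discMap fun j : ULift.{u} (Fin (m i)) => ULift.up.{u} (e ⟨i, j.down⟩))) (s i)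
  have hs' (i) : U.map (F.map (tuple w)) (s' i) = a i := by
    rw [← hs i, map_map_apply]
    refine congrArg (fun p : _ ⟶ X => U.map (F.map p) (s i)) (PartOrd.ext fun j => ?_)
    change x (e.symm (e ⟨i, j.down⟩)).1 (e.symm (e ⟨i, j.down⟩)).2 = x i j.down
    rw [Equiv.symm_apply_apply]
  obtain rfl : (fun i => U.map (F.map (tuple w)) (s' i)) = a := funext hs'
  let r : Sig U F N := extend adj (tuple s') t
  have hr : extend adj (tuple fun i => U.map (F.map (tuple w)) (s' i)) t =
      U.map (F.map (tuple w)) r := (map_extend_apply adj (tuple s') (F.map (tuple w)) t).symm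
  rw [hr]
  simp only [hk]
  have hB (B : K) (y : Fin N → U.obj B) : extend adj (tuple y) r =
      extend adj (tuple fun i => extend adj (tuple y) (s' i)) t :=
    map_extend_apply adj (tuple s') ((adj.homEquiv _ _).symm (tuple y)) t
  refine le_antisymm ?_ ?_
  · obtain ⟨y', hy', H⟩ := eval_le_eval A (fun j => h (w j)) (A.obj.op r fun j => h (w j))
      (p := .app r fun j => .var j) (q := .app t fun i => .app (s' i) fun j => .var j)
      fun B y => (hB B fun j => y j).le
    simp only [OrdTerm.eval, hy'] at H
    exact H
  · obtain ⟨y', hy', H⟩ := eval_le_eval A (fun j => h (w j)) (A.obj.op r fun j => h (w j))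
      (q := .app r fun j => .var j) (p := .app t fun i => .app (s' i) fun j => .var j)
      fun B y => (hB B fun j => y j).ge
    simp only [OrdTerm.eval, hy'] at H
    exact H

/-- The extension to a free object extends the given map. -/
theorem extension_unit {A : Variety (inequations adj hF hU)} {X : PartOrd.{u}}
    {h : X → A.obj.carrier} {k : U.obj (F.obj X) ⟶ (Variety.forget _).obj A}
    (hk : ∀ (n : ℕ) (x : Fin n → X) (t : Sig U F n),
      k (U.map (F.map (tuple x)) t) = A.obj.op t (fun i => h (x i))) (a : X) :
    k (adj.unit.app X a) = h a := by
  let t : Sig U F 1 := adj.unit.app (disc (ULift.{u} (Fin 1))) (⟨0⟩ : ULift.{u} (Fin 1))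
  have ht : adj.unit.app X a = U.map (F.map (tuple fun _ : Fin 1 => a)) t :=
    congrArg (fun k : disc (ULift.{u} (Fin 1)) ⟶ U.obj (F.obj X) => k (⟨0⟩ : ULift.{u} (Fin 1)))
      (adj.unit.naturality (tuple fun _ : Fin 1 => a))
  have hB (B : K) (y : Fin 1 → U.obj B) : extend adj (tuple y) t = y 0 :=
    extend_unit_apply adj (tuple y) (⟨0⟩ : ULift.{u} (Fin 1))
  rw [ht]
  refine (hk 1 _ t).trans (le_antisymm ?_ ?_)
  · obtain ⟨y', hy', H⟩ := eval_le_eval A (fun _ : Fin 1 => h a) (h a)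
      (p := .app t fun j => .var j) (q := .var (0 : Fin 1)) fun B y => (hB B fun j => y j).le
    simp only [OrdTerm.eval, hy'] at H
    exact H
  · obtain ⟨y', hy', H⟩ := eval_le_eval A (fun _ : Fin 1 => h a) (h a)
      (q := .app t fun j => .var j) (p := .var (0 : Fin 1)) fun B y => (hB B fun j => y j).ge
    simp only [OrdTerm.eval, hy'] at H
    exact H

end Extension

end Comparison

/-! ### The comparison functor is essentially surjective -/

section EssSurj

variable {K : Type w} [Category.{u} K] [PosEnriched K] {U : K ⥤ PartOrd.{u}}
  {F : PartOrd.{u} ⥤ K} (adj : F ⊣ U) (hF : IsPosFunctor F) (hU : IsPosFunctor U)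

/-- Every algebra `A` of the variety is presented as a reflexive coinserter of free objects: the
generators are the elements of `A`, and the relations are all pairs of elements `a, b` of the free
object whose values in `A` satisfy `a ≤ b`. -/
theorem exists_iso_comparison (hfin : IsFinitary U) (hpres : PreservesReflexiveCoinserters U)
    (hK : HasReflexiveCoinserters K) (A : Variety (inequations adj hF hU)) :
    ∃ C : K, Nonempty ((comparison adj hF hU).obj C ≅ A) := by
  let X : PartOrd.{u} := (Variety.forget _).obj A
  obtain ⟨k, hk⟩ := exists_extension hfin hpres A (X := X) OrderHom.id
  have hop {n : ℕ} (t : Sig U F n) (a : Fin n → U.obj (F.obj X)) :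
      k (extend adj (tuple a) t) = A.obj.op t (fun i => k (a i)) := extension_op hfin hpres hk t a
  have hunit (a : X) : k (adj.unit.app X a) = a := extension_unit hk a
  let Y : PartOrd.{u} := PartOrd.of {p : U.obj (F.obj X) × U.obj (F.obj X) // k p.1 ≤ k p.2}
  let p₀ : Y ⟶ U.obj (F.obj X) := PartOrd.ofHom ⟨fun p => p.1.1, fun _ _ h => h.1⟩
  let p₁ : Y ⟶ U.obj (F.obj X) := PartOrd.ofHom ⟨fun p => p.1.2, fun _ _ h => h.2⟩
  let u₀ : F.obj Y ⟶ F.obj X := (adj.homEquiv _ _).symm p₀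
  let u₁ : F.obj Y ⟶ F.obj X := (adj.homEquiv _ _).symm p₁
  have hu : IsReflexivePos u₀ u₁ := by
    let δ : X ⟶ Y := PartOrd.ofHom ⟨fun a => ⟨(adj.unit.app X a, adj.unit.app X a), le_rfl⟩,
      fun _ _ h => Subtype.mk_le_mk.2 ⟨(adj.unit.app X).hom.monotone h,
        (adj.unit.app X).hom.monotone h⟩⟩
    have h : (adj.homEquiv X (F.obj X)).symm (adj.unit.app X) = 𝟙 _ := by
      rw [Equiv.symm_apply_eq, adj.homEquiv_unit]
      simp
    exact ⟨F.map δ, (adj.homEquiv_naturality_left_symm δ p₀).symm.trans h,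
      (adj.homEquiv_naturality_left_symm δ p₁).symm.trans h⟩
  obtain ⟨C, c, hc⟩ := hK u₀ u₁ hu
  have hUc := hpres u₀ u₁ c hu hc
  have hkc : IsCoinserter (U.map u₀) (U.map u₁) k := by
    refine isCoinserter_of_surjective (fun a => ⟨_, hunit a⟩) (fun v => ?_) fun f' hf' a b h => ?_
    · obtain ⟨n, y, t, rfl⟩ := exists_map_tuple_eq adj hF hU hfin hpres v
      have e (p : Y ⟶ U.obj (F.obj X)) : k (extend adj p (U.map (F.map (tuple y)) t)) =
          A.obj.op t (fun i => k (p (y i))) := by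
        rw [extend_map_apply]
        exact hop t fun i => p (y i)
      exact (e p₀).le.trans (le_trans (A.obj.op_mono t fun i => (y i).2) (e p₁).ge)
    · have h' := hf' (adj.unit.app Y ⟨(a, b), h⟩)
      have e (p : Y ⟶ U.obj (F.obj X)) := extend_unit_apply adj p ⟨(a, b), h⟩
      exact (congrArg f' (e p₀)).ge.trans (h'.trans (congrArg f' (e p₁)).le)
  obtain ⟨e, he⟩ := hUc.exists_iso hkc
  have he' (a) : e.hom (U.map c a) = k a := congrArg (fun k : U.obj (F.obj X) ⟶ X => k a) he
  have hom_op {n : ℕ} (t : Sig U F n) (x : Fin n → U.obj C) :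
      e.hom (extend adj (tuple x) t) = A.obj.op t (fun i => e.hom (x i)) := by
    choose y hy using fun i => hUc.surjective (x i)
    obtain rfl : (fun i => U.map c (y i)) = x := funext hy
    have := map_extend_apply adj (tuple y) c t
    rw [tuple_comp] at this
    rw [← this, he', hop]
    exact congrArg _ (funext fun i => (he' _).symm)
  have inv_op {n : ℕ} (t : Sig U F n) (x : Fin n → X) :
      e.inv (A.obj.op t x) = extend adj (tuple fun i => e.inv (x i)) t := by
    rw [← PartOrd.inv_hom_apply e (extend adj (tuple fun i => e.inv (x i)) t), hom_op]
    simp only [PartOrd.hom_inv_apply]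
  exact ⟨C, ⟨⟨Variety.mkHom (A := comparisonObj adj hF hU C) e.hom.hom hom_op,
    Variety.mkHom (B := comparisonObj adj hF hU C) e.inv.hom inv_op,
    Variety.hom_ext fun a => PartOrd.inv_hom_apply e a,
    Variety.hom_ext fun a => PartOrd.hom_inv_apply e a⟩⟩⟩

end EssSurj

theorem isEquivalentToVariety_of_properties {K : Type w} [Category.{u} K] [PosEnriched K]
    {U : K ⥤ PartOrd.{u}} (hU : IsPosFunctor U) (hsub : HasSubkernelPairs K)
    (hcoins : HasReflexiveCoinserters K) (hfin : IsFinitary U) (hadj : IsPosRightAdjoint U)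
    (hrefl : ReflectsSubregularEpis U) (hpres : PreservesReflexiveCoinserters U) :
    IsEquivalentToVariety U := by
  obtain ⟨F, hF, ⟨adj⟩⟩ := hadj
  have hle {A B : K} (f g : A ⟶ B) :
      (comparison adj hF hU).map f ≤ (comparison adj hF hU).map g ↔ f ≤ g :=
    map_le_map_iff adj hF hU hrefl
  refine ⟨Sig U F, inequations adj hF hU, comparison adj hF hU, ⟨?_, fun _ _ => hle⟩,
    comparison_comp_forget adj hF hU⟩
  exact
    { faithful := ⟨fun h => le_antisymm ((hle _ _).1 h.le) ((hle _ _).1 h.ge)⟩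
      full := ⟨fun h => exists_comparison_map_eq adj hF hU hfin hpres hrefl hsub h⟩
      essSurj := ⟨fun A => exists_iso_comparison adj hF hU hfin hpres hcoins A⟩ }

end OrderedVarieties

theorem corollary6p2 {K : Type w} [Category.{u} K] [OrderedVarieties.PosEnriched K]
    (U : K ⥤ PartOrd.{u}) (hU : OrderedVarieties.IsPosFunctor U) [U.Faithful] :
    OrderedVarieties.IsEquivalentToVariety U ↔
      (OrderedVarieties.HasSubkernelPairs K ∧ OrderedVarieties.HasReflexiveCoinserters K) ∧
      (OrderedVarieties.IsFinitary U ∧ OrderedVarieties.IsPosRightAdjoint U ∧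
        OrderedVarieties.ReflectsSubregularEpis U ∧
        OrderedVarieties.PreservesReflexiveCoinserters U) :=
  ⟨OrderedVarieties.properties_of_isEquivalentToVariety,
    fun ⟨⟨hsub, hcoins⟩, hfin, hadj, hrefl, hpres⟩ =>
      OrderedVarieties.isEquivalentToVariety_of_properties hU hsub hcoins hfin hadj hrefl hpres⟩
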